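/- Let $\ell_1,\ell_2,\kappa,\rho,\mu,\beta>0$, $\gamma\in\mathbb R\setminus\{0\}$, $\chi\in\mathbb R$ with $\chi_1:=\chi-\gamma^2\beta>0$, $0<\alpha<1$ and $\eta\ge 0$. Put $\mathfrak C=\pi^{-1}\sin(\alpha\pi)$ and $m(\xi)=|\xi|^{(2\alpha-1)/2}$ for $\xi\in\mathbb R$. All function spaces are complex. Let $$H^1_R(0,\ell_2)=\{u\in H^1(0,\ell_2):u(\ell_2)=0\},\qquad H^1_L(-\ell_1,0)=\{u\in H^1(-\ell_1,0):u(-\ell_1)=0\},$$ and let the energy space $$\mathcal H=L^2(-\ell_1,0)\times H^1_R(0,\ell_2)\times L^2(0,\ell_2)\times H^1_R(0,\ell_2)\times L^2(0,\ell_2)\times L^2(\mathbb R;L^2(0,\ell_2))$$ carry the norm (induced by the corresponding inner product) $$\|(z,v,V,p,Q,\varphi)\|_{\mathcal H}^2=\|z\|^2+\chi_1\|v_x\|^2+\rho\|V\|^2+\mu\|Q\|^2+\beta\|\gamma v_x-p_x\|^2+\mathfrak C\|\varphi\|^2,$$ where each norm on the right-hand side is the $L^2$ norm. Let $\mathcal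 A:D(\mathcal A)\subset\mathcal H\to\mathcal H$ be the operator $$\mathcal A\begin{pmatrix}z\\v\\V\\p\\Q\\\varphi\end{pmatrix}=\begin{pmatrix}\kappa z_{xx}\\V\\\frac1\rho\big(\chi v_{xx}-\gamma\beta p_{xx}-\mathfrak C\int_{\mathbb R}m(\xi)\varphi(\xi)\,d\xi\big)\\Q\\\frac1\mu\big(\beta p_{xx}-\gamma\beta v_{xx}\big)\\-(\xi^2+\eta)\varphi(\xi)+m(\xi)V\end{pmatrix},$$ whose domain $D(\mathcal A)$ consists of all $(z,v,V,p,Q,\varphi)\in\mathcal H$ with $z\in H^1_L(-\ell_1,0)\cap H^2(-\ell_1,0)$, $v,p\in H^1_R(0,\ell_2)\cap H^2(0,\ell_2)$, $V,Q\in H^1_R(0,\ell_2)$, $|\xi|\varphi\in L^2(\mathbb R;L^2(0,\ell_2))$, $-(\xi^2+\eta)\varphi+m(\xi)V\in L^2(\mathbb R;L^2(0,\ell_2))$, and $$z(0)=V(0),\qquad \chi v_x(0)-\gamma\beta p_x(0)=\kappa z_x(0),\qquad \beta p_x(0)=\gamma\beta v_x(0).$$ Let $\rho(\mathcal A)$ denote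 the resolvent set of $\mathcal A$, that is, the set of all $s\in\mathbb C$ for which $s-\mathcal A:D(\mathcal A)\to\mathcal H$ is bijective with bounded inverse. Then: (i) if $\eta>0$, then $i\mathbb R\subseteq\rho(\mathcal A)$; (ii) if $\eta=0$, then $i\mathbb R^{*}\subseteq\rho(\mathcal A)$, where $\mathbb R^{*}=\mathbb R\setminus\{0\}$. -/

import Mathlib

open MeasureTheory Set
open scoped ContDiff ComplexConjugate

noncomputable section

namespace PiezoHeat

/-! ### Sobolev spaces on a bounded interval -/

/-- The complex Lebesgue space `L²(a, b)`. -/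
abbrev L2 (a b : ℝ) : Type := Lp ℂ 2 (volume.restrict (Ioo a b))

/-- `g ∈ L²(a, b)` is the weak derivative of `u ∈ L²(a, b)`: `∫ u ψ' = - ∫ g ψ` for all test
functions `ψ ∈ C_c^∞(a, b)`. -/
def HasWeakDeriv {a b : ℝ} (u g : L2 a b) : Prop :=
  ∀ ψ : ℝ → ℝ, ContDiff ℝ ∞ ψ → HasCompactSupport ψ → tsupport ψ ⊆ Ioo a b →
    ∫ x in Ioo a b, deriv ψ x • u x = - ∫ x in Ioo a b, ψ x • g x

/-- The continuous representative of `u` on `[a, b]` takes the value `c` at `x₀ ∈ [a, b]`. -/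
def HasBoundaryValue {a b : ℝ} (u : L2 a b) (x₀ : ℝ) (c : ℂ) : Prop :=
  ∃ f : ℝ → ℂ, ContinuousOn f (Icc a b) ∧ u =ᵐ[volume.restrict (Ioo a b)] f ∧ f x₀ = c

section aux

variable {a b : ℝ}

theorem integrableOn_test_smul {ψ : ℝ → ℝ} (hψ : Continuous ψ) (hc : HasCompactSupport ψ)
    (u : L2 a b) : Integrable (fun x => ψ x • u x) (volume.restrict (Ioo a b)) := by
  have hu : Integrable u (volume.restrict (Ioo a b)) := (Lp.memLp u).integrable (by norm_num)
  obtain ⟨C, hC⟩ := hc.exists_bound_of_continuous hψ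
  exact hu.bdd_smul C hψ.aestronglyMeasurable (Filter.Eventually.of_forall hC)

theorem integrableOn_deriv_smul {ψ : ℝ → ℝ} (hψ : ContDiff ℝ ∞ ψ) (hc : HasCompactSupport ψ)
    (u : L2 a b) : Integrable (fun x => deriv ψ x • u x) (volume.restrict (Ioo a b)) :=
  integrableOn_test_smul (hψ.continuous_deriv (by simp)) hc.deriv u

theorem HasWeakDeriv.add {u v g h : L2 a b} (hu : HasWeakDeriv u g) (hv : HasWeakDeriv v h) :
    HasWeakDeriv (u + v) (g + h) := by
  intro ψ h1 h2 h3
  have e1 : ∫ x in Ioo a b, deriv ψ x • (u + v : L2 a b) x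
      = ∫ x in Ioo a b, (deriv ψ x • u x + deriv ψ x • v x) := by
    refine integral_congr_ae ?_
    filter_upwards [Lp.coeFn_add u v] with x hx
    rw [hx, Pi.add_apply, smul_add]
  have e2 : ∫ x in Ioo a b, ψ x • (g + h : L2 a b) x
      = ∫ x in Ioo a b, (ψ x • g x + ψ x • h x) := by
    refine integral_congr_ae ?_
    filter_upwards [Lp.coeFn_add g h] with x hx
    rw [hx, Pi.add_apply, smul_add]
  rw [e1, e2, integral_add (integrableOn_deriv_smul h1 h2 u) (integrableOn_deriv_smul h1 h2 v),
    integral_add (integrableOn_test_smul h1.continuous h2 g)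
      (integrableOn_test_smul h1.continuous h2 h), hu ψ h1 h2 h3, hv ψ h1 h2 h3]
  ring

theorem HasWeakDeriv.smul {u g : L2 a b} (c : ℂ) (hu : HasWeakDeriv u g) :
    HasWeakDeriv (c • u) (c • g) := by
  intro ψ h1 h2 h3
  have e1 : ∫ x in Ioo a b, deriv ψ x • (c • u : L2 a b) x
      = ∫ x in Ioo a b, c • (deriv ψ x • u x) := by
    refine integral_congr_ae ?_
    filter_upwards [Lp.coeFn_smul c u] with x hx
    rw [hx, Pi.smul_apply, smul_comm]
  have e2 : ∫ x in Ioo a b, ψ x • (c • g : L2 a b) x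
      = ∫ x in Ioo a b, c • (ψ x • g x) := by
    refine integral_congr_ae ?_
    filter_upwards [Lp.coeFn_smul c g] with x hx
    rw [hx, Pi.smul_apply, smul_comm]
  rw [e1, e2, integral_smul, integral_smul, hu ψ h1 h2 h3, smul_neg]

theorem HasWeakDeriv.zero : HasWeakDeriv (0 : L2 a b) 0 := by
  intro ψ h1 h2 h3
  have e1 : ∀ θ : ℝ → ℝ, ∫ x in Ioo a b, θ x • (0 : L2 a b) x = 0 := by
    intro θ
    rw [← integral_zero ℝ ℂ (μ := volume.restrict (Ioo a b))]
    refine integral_congr_ae ?_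
    filter_upwards [Lp.coeFn_zero ℂ 2 (volume.restrict (Ioo a b))] with x hx
    rw [hx, Pi.zero_apply, smul_zero]
  rw [e1, e1, neg_zero]

/-- Weak derivatives are unique. -/
theorem HasWeakDeriv.unique {u g h : L2 a b} (hg : HasWeakDeriv u g) (hh : HasWeakDeriv u h) :
    g = h := by
  have hgi : Integrable g (volume.restrict (Ioo a b)) := (Lp.memLp g).integrable (by norm_num)
  have hhi : Integrable h (volume.restrict (Ioo a b)) := (Lp.memLp h).integrable (by norm_num)
  have key := (isOpen_Ioo (a := a) (b := b)).ae_eq_zero_of_integral_contDiff_smul_eq_zero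
    (μ := volume) (f := fun x => g x - h x)
    (IntegrableOn.locallyIntegrableOn (hgi.sub hhi)) (by
      intro ψ h1 h2 h3
      have h4 : ∫ x in Ioo a b, ψ x • (g x - h x) = ∫ x, ψ x • (g x - h x) := by
        refine setIntegral_eq_integral_of_forall_compl_eq_zero fun x hx => ?_
        rw [image_eq_zero_of_notMem_tsupport (fun hx' => hx (h3 hx')), zero_smul]
      rw [← h4]
      simp_rw [smul_sub]
      rw [integral_sub (integrableOn_test_smul h1.continuous h2 g)
        (integrableOn_test_smul h1.continuous h2 h), sub_eq_zero]
      exact neg_injective ((hg ψ h1 h2 h3).symm.trans (hh ψ h1 h2 h3)))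
  refine Lp.ext ?_
  rw [Filter.EventuallyEq, ae_restrict_iff' measurableSet_Ioo]
  filter_upwards [key] with x hx hx'
  exact sub_eq_zero.1 (hx hx')

/-- A smooth function with compact support in `(a, b)` and vanishing integral is the derivative
of a test function. -/
theorem exists_test_primitive {h : ℝ → ℝ} (h1 : ContDiff ℝ ∞ h)
    (h2 : HasCompactSupport h) (h3 : tsupport h ⊆ Ioo a b) (h0 : ∫ x, h x = 0) (hab : a < b) :
    ∃ ψ : ℝ → ℝ, ContDiff ℝ ∞ ψ ∧ HasCompactSupport ψ ∧ tsupport ψ ⊆ Ioo a b ∧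
      deriv ψ = h := by
  obtain ⟨m, hm⟩ := exists_between hab
  have hK : IsCompact (insert m (tsupport h)) := h2.isCompact.insert m
  have hKs : insert m (tsupport h) ⊆ Ioo a b := insert_subset hm h3
  obtain ⟨c, hc⟩ := hK.exists_isLeast ⟨m, mem_insert _ _⟩
  obtain ⟨d, hd⟩ := hK.exists_isGreatest ⟨m, mem_insert _ _⟩
  have hz : ∀ x, x ∉ Icc c d → h x = 0 := by
    intro x hx
    refine image_eq_zero_of_notMem_tsupport fun hx' => hx ?_
    exact ⟨hc.2 (mem_insert_of_mem _ hx'), hd.2 (mem_insert_of_mem _ hx')⟩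
  have hder : ∀ x, HasDerivAt (fun x => ∫ t in a..x, h t) (h x) x := fun x =>
    intervalIntegral.integral_hasDerivAt_right (h1.continuous.intervalIntegrable _ _)
      (h1.continuous.stronglyMeasurableAtFilter _ _) h1.continuous.continuousAt
  have hderiv : deriv (fun x => ∫ t in a..x, h t) = h := funext fun x => (hder x).deriv
  have hca : a < c := (hKs hc.1).1
  have hdb : d < b := (hKs hd.1).2
  have hsupp : Function.support (fun x => ∫ t in a..x, h t) ⊆ Icc c d := by
    intro x hx
    by_contra hx'
    apply hx
    rw [mem_Icc, not_and_or, not_le, not_le] at hx'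
    rcases hx' with hx' | hx'
    · change ∫ t in a..x, h t = 0
      rw [← intervalIntegral.integral_zero (a := a) (b := x)]
      refine intervalIntegral.integral_congr fun t ht => hz t fun ht' => ?_
      have := ht.2
      have h5 : max a x < c := max_lt hca hx'
      exact absurd ht'.1 (not_le.2 (lt_of_le_of_lt this h5))
    · change ∫ t in a..x, h t = 0
      have h6 : a < x := hca.trans_le ((hc.2 hd.1).trans hx'.le)
      rw [intervalIntegral.integral_of_le h6.le, ← h0]
      refine setIntegral_eq_integral_of_forall_compl_eq_zero fun t ht => hz t fun ht' => ht ?_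
      exact ⟨hca.trans_le ht'.1, ht'.2.trans hx'.le⟩
  have hts : tsupport (fun x => ∫ t in a..x, h t) ⊆ Icc c d :=
    closure_minimal hsupp isClosed_Icc
  refine ⟨fun x => ∫ t in a..x, h t, ?_, ?_, ?_, hderiv⟩
  · rw [contDiff_infty_iff_deriv, hderiv]
    exact ⟨fun x => (hder x).differentiableAt, h1⟩
  · exact HasCompactSupport.of_support_subset_isCompact isCompact_Icc hsupp
  · exact hts.trans (Icc_subset_Ioo hca hdb)

/-- A function with vanishing weak derivative is constant. -/
theorem HasWeakDeriv.ae_const {u : L2 a b} (hab : a < b) (hu : HasWeakDeriv u 0) :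
    ∃ c : ℂ, ∀ᵐ x ∂(volume.restrict (Ioo a b)), u x = c := by
  have hui : Integrable u (volume.restrict (Ioo a b)) := (Lp.memLp u).integrable (by norm_num)
  obtain ⟨f, hf1, hf2, hf3, hf4⟩ : ∃ f : ℝ → ℝ, ContDiff ℝ ∞ f ∧ HasCompactSupport f ∧
      tsupport f ⊆ Ioo a b ∧ ∫ x, f x = 1 := by
    let f : ContDiffBump ((a + b) / 2) :=
      ⟨(b - a) / 8, (b - a) / 4, by linarith, by linarith⟩
    refine ⟨f.normed volume, f.contDiff_normed, f.hasCompactSupport_normed, ?_,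
      f.integral_normed⟩
    rw [f.tsupport_normed_eq, Real.closedBall_eq_Icc]
    refine Icc_subset_Ioo ?_ ?_ <;> (simp only [f]; linarith)
  have hzero : ∀ ψ : ℝ → ℝ, ContDiff ℝ ∞ ψ → HasCompactSupport ψ → tsupport ψ ⊆ Ioo a b →
      ∫ x in Ioo a b, deriv ψ x • u x = 0 := by
    intro ψ h1 h2 h3
    have e1 : ∫ x in Ioo a b, ψ x • (0 : L2 a b) x = 0 := by
      rw [← integral_zero ℝ ℂ (μ := volume.restrict (Ioo a b))]
      refine integral_congr_ae ?_
      filter_upwards [Lp.coeFn_zero ℂ 2 (volume.restrict (Ioo a b))] with x hx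
      rw [hx, Pi.zero_apply, smul_zero]
    rw [hu ψ h1 h2 h3, e1, neg_zero]
  set c : ℂ := ∫ x in Ioo a b, f x • u x with hcdef
  refine ⟨c, ?_⟩
  have key := (isOpen_Ioo (a := a) (b := b)).ae_eq_zero_of_integral_contDiff_smul_eq_zero
    (μ := volume) (f := fun x => u x - c)
    (IntegrableOn.locallyIntegrableOn (hui.sub (integrable_const c))) (by
      intro ψ h1 h2 h3
      have hψi : Integrable ψ := h1.continuous.integrable_of_hasCompactSupport h2
      have hfi : Integrable f := hf1.continuous.integrable_of_hasCompactSupport hf2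
      obtain ⟨θ, t1, t2, t3, t4⟩ := exists_test_primitive (a := a) (b := b)
        (h := fun x => ψ x - (∫ y, ψ y) * f x) (h1.sub (contDiff_const.mul hf1))
        (h2.sub (hf2.mul_left))
        ((tsupport_sub _ _).trans (union_subset h3
          ((tsupport_mul_subset_right).trans hf3)))
        (by rw [integral_sub hψi (hfi.const_mul _), integral_const_mul, hf4, mul_one, sub_self])
        hab
      have h4 : ∫ x in Ioo a b, ψ x • (u x - c) = ∫ x, ψ x • (u x - c) := by
        refine setIntegral_eq_integral_of_forall_compl_eq_zero fun x hx => ?_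
        rw [image_eq_zero_of_notMem_tsupport (fun hx' => hx (h3 hx')), zero_smul]
      have h5 : ∫ x in Ioo a b, ψ x = ∫ x, ψ x := by
        refine setIntegral_eq_integral_of_forall_compl_eq_zero fun x hx => ?_
        rw [image_eq_zero_of_notMem_tsupport (fun hx' => hx (h3 hx'))]
      have h6 := hzero θ t1 t2 t3
      rw [t4] at h6
      have h7 : ∀ x, (ψ x - (∫ y, ψ y) * f x) • u x
          = ψ x • u x - (∫ y, ψ y) • (f x • u x) := fun x => by
        rw [sub_smul, mul_smul]
      simp_rw [h7] at h6
      have h8 : Integrable (fun x => (∫ y, ψ y) • (f x • u x)) (volume.restrict (Ioo a b)) :=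
        (integrableOn_test_smul hf1.continuous hf2 u).smul (∫ y, ψ y)
      rw [integral_sub (integrableOn_test_smul h1.continuous h2 u) h8,
        integral_smul, ← hcdef] at h6
      rw [← h4]
      simp_rw [smul_sub]
      rw [integral_sub (integrableOn_test_smul h1.continuous h2 u)
        (hψi.integrableOn.smul_const c), integral_smul_const, h5]
      exact h6)
  rw [ae_restrict_iff' measurableSet_Ioo]
  filter_upwards [key] with x hx hx'
  exact sub_eq_zero.1 (hx hx')

theorem HasBoundaryValue.add {u v : L2 a b} {x₀ : ℝ} {c d : ℂ} (hu : HasBoundaryValue u x₀ c)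
    (hv : HasBoundaryValue v x₀ d) : HasBoundaryValue (u + v) x₀ (c + d) := by
  obtain ⟨f, f1, f2, f3⟩ := hu
  obtain ⟨g, g1, g2, g3⟩ := hv
  refine ⟨f + g, f1.add g1, (Lp.coeFn_add u v).trans (f2.add g2), ?_⟩
  rw [Pi.add_apply, f3, g3]

theorem HasBoundaryValue.smul {u : L2 a b} {x₀ : ℝ} {c : ℂ} (r : ℂ)
    (hu : HasBoundaryValue u x₀ c) : HasBoundaryValue (r • u) x₀ (r * c) := by
  obtain ⟨f, f1, f2, f3⟩ := hu
  refine ⟨r • f, f1.const_smul r, (Lp.coeFn_smul r u).trans (f2.const_smul r), ?_⟩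
  rw [Pi.smul_apply, f3, smul_eq_mul]

theorem HasBoundaryValue.zero (x₀ : ℝ) : HasBoundaryValue (0 : L2 a b) x₀ 0 :=
  ⟨0, continuousOn_const, Lp.coeFn_zero _ _ _, rfl⟩

theorem HasBoundaryValue.unique {u : L2 a b} {x₀ : ℝ} {c d : ℂ} (hab : a < b)
    (hx₀ : x₀ ∈ Icc a b) (hc : HasBoundaryValue u x₀ c) (hd : HasBoundaryValue u x₀ d) :
    c = d := by
  obtain ⟨f, f1, f2, rfl⟩ := hc
  obtain ⟨g, g1, g2, rfl⟩ := hd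
  have h : f =ᵐ[volume.restrict (Icc a b)] g := by
    rw [← restrict_Ioo_eq_restrict_Icc]
    exact f2.symm.trans g2
  exact Measure.eqOn_Icc_of_ae_eq volume hab.ne h f1 g1 hx₀

end aux

/-- The Sobolev space `H¹(a, b)`. -/
def H1 (a b : ℝ) : Submodule ℂ (L2 a b) where
  carrier := {u | ∃ g, HasWeakDeriv u g}
  add_mem' := fun ⟨g, hg⟩ ⟨h, hh⟩ => ⟨g + h, hg.add hh⟩
  zero_mem' := ⟨0, HasWeakDeriv.zero⟩
  smul_mem' := fun c _ ⟨g, hg⟩ => ⟨c • g, hg.smul c⟩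

open Classical in
/-- The weak derivative `u_x` of `u ∈ H¹(a, b)` (and `0` for `u ∉ H¹(a, b)`). -/
def wderiv {a b : ℝ} (u : L2 a b) : L2 a b :=
  if h : ∃ g, HasWeakDeriv u g then h.choose else 0

theorem hasWeakDeriv_wderiv {a b : ℝ} {u : L2 a b} (hu : u ∈ H1 a b) :
    HasWeakDeriv u (wderiv u) := by
  have hu' : ∃ g, HasWeakDeriv u g := hu
  rw [wderiv, dif_pos hu']
  exact hu'.choose_spec

theorem HasWeakDeriv.wderiv_eq {a b : ℝ} {u g : L2 a b} (h : HasWeakDeriv u g) :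
    wderiv u = g :=
  (hasWeakDeriv_wderiv ⟨g, h⟩).unique h

theorem wderiv_add {a b : ℝ} {u v : L2 a b} (hu : u ∈ H1 a b) (hv : v ∈ H1 a b) :
    wderiv (u + v) = wderiv u + wderiv v :=
  ((hasWeakDeriv_wderiv hu).add (hasWeakDeriv_wderiv hv)).wderiv_eq

theorem wderiv_smul {a b : ℝ} {u : L2 a b} (c : ℂ) (hu : u ∈ H1 a b) :
    wderiv (c • u) = c • wderiv u :=
  ((hasWeakDeriv_wderiv hu).smul c).wderiv_eq

theorem wderiv_zero {a b : ℝ} : wderiv (0 : L2 a b) = 0 := HasWeakDeriv.zero.wderiv_eq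

/-- The Sobolev space `H²(a, b)`. -/
def H2 (a b : ℝ) : Submodule ℂ (L2 a b) where
  carrier := {u | u ∈ H1 a b ∧ wderiv u ∈ H1 a b}
  add_mem' := fun hu hv => ⟨add_mem hu.1 hv.1, by
    rw [wderiv_add hu.1 hv.1]; exact add_mem hu.2 hv.2⟩
  zero_mem' := ⟨zero_mem _, by rw [wderiv_zero]; exact zero_mem _⟩
  smul_mem' := fun c u hu => ⟨Submodule.smul_mem _ c hu.1, by
    rw [wderiv_smul c hu.1]; exact Submodule.smul_mem _ c hu.2⟩

/-- The space of all `u ∈ H¹(a, b)` with `u(x₀) = 0`, where `x₀ ∈ [a, b]`. -/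
def H1Vanishing (a b x₀ : ℝ) : Submodule ℂ (L2 a b) where
  carrier := {u | u ∈ H1 a b ∧ HasBoundaryValue u x₀ 0}
  add_mem' := fun hu hv => ⟨add_mem hu.1 hv.1, by simpa using hu.2.add hv.2⟩
  zero_mem' := ⟨zero_mem _, HasBoundaryValue.zero x₀⟩
  smul_mem' := fun c u hu => ⟨Submodule.smul_mem _ c hu.1, by simpa using hu.2.smul c⟩

theorem eq_zero_of_wderiv_eq_zero {a b x₀ : ℝ} (hab : a < b) (hx₀ : x₀ ∈ Icc a b) {u : L2 a b}
    (hu : u ∈ H1Vanishing a b x₀) (h : wderiv u = 0) : u = 0 := by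
  have h1 : HasWeakDeriv u 0 := h ▸ hasWeakDeriv_wderiv hu.1
  obtain ⟨c, hc⟩ := h1.ae_const hab
  have h2 : HasBoundaryValue u x₀ c := ⟨fun _ => c, continuousOn_const, hc, rfl⟩
  have h3 : c = 0 := h2.unique hab hx₀ hu.2
  refine Lp.ext ?_
  filter_upwards [hc, Lp.coeFn_zero ℂ 2 (volume.restrict (Ioo a b))] with x hx hx'
  rw [hx, hx', h3, Pi.zero_apply]

/-! ### The system -/

/-- The parameters of the coupled heat / piezoelectric beam system: the heat-conducting rod
occupies `(-ℓ₁, 0)` and the beam `(0, ℓ₂)`; `α` and `η` are the order and the weight of the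
fractional derivative. -/
structure Params where
  (ℓ₁ ℓ₂ κ ρ μ β γ χ α η : ℝ)
  ℓ₁_pos : 0 < ℓ₁
  ℓ₂_pos : 0 < ℓ₂
  κ_pos : 0 < κ
  ρ_pos : 0 < ρ
  μ_pos : 0 < μ
  β_pos : 0 < β
  γ_ne : γ ≠ 0
  χ₁_pos : 0 < χ - γ ^ 2 * β
  α_pos : 0 < α
  α_lt_one : α < 1
  η_nonneg : 0 ≤ η

namespace Params

variable (P : Params)

/-- `χ₁ = χ - γ² β`. -/
def χ₁ : ℝ := P.χ - P.γ ^ 2 * P.β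

/-- The constant `𝔠 = π⁻¹ sin (α π)`. -/
def 𝔠 : ℝ := Real.pi⁻¹ * Real.sin (P.α * Real.pi)

/-- The function `m(ξ) = |ξ|^((2α - 1)/2)`. -/
def m (ξ : ℝ) : ℝ := |ξ| ^ ((2 * P.α - 1) / 2)

theorem 𝔠_pos : 0 < P.𝔠 := by
  refine mul_pos (inv_pos.2 Real.pi_pos) (Real.sin_pos_of_pos_of_lt_pi
    (mul_pos P.α_pos Real.pi_pos) ?_)
  have := mul_lt_mul_of_pos_right P.α_lt_one Real.pi_pos
  linarith

end Params

/-- The space `L²(ℝ; L²(0, ℓ₂))`, whose elements are `ξ ↦ φ(·, ξ)`. -/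
abbrev MemorySpace (P : Params) : Type := Lp (L2 0 P.ℓ₂) 2 (volume : Measure ℝ)

/-- The energy space
`L²(-ℓ₁,0) × H¹_R(0,ℓ₂) × L²(0,ℓ₂) × H¹_R(0,ℓ₂) × L²(0,ℓ₂) × L²(ℝ; L²(0,ℓ₂))`,
where `H¹_R(0,ℓ₂)` is the space of `u ∈ H¹(0,ℓ₂)` with `u(ℓ₂) = 0`. -/
def EnergySpace (P : Params) : Type :=
  L2 (-P.ℓ₁) 0 × H1Vanishing 0 P.ℓ₂ P.ℓ₂ × L2 0 P.ℓ₂ × H1Vanishing 0 P.ℓ₂ P.ℓ₂ × L2 0 P.ℓ₂ ×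
    MemorySpace P

namespace EnergySpace

variable {P : Params}

instance : AddCommGroup (EnergySpace P) :=
  inferInstanceAs (AddCommGroup (L2 (-P.ℓ₁) 0 × H1Vanishing 0 P.ℓ₂ P.ℓ₂ × L2 0 P.ℓ₂ ×
    H1Vanishing 0 P.ℓ₂ P.ℓ₂ × L2 0 P.ℓ₂ × MemorySpace P))

instance : Module ℂ (EnergySpace P) :=
  inferInstanceAs (Module ℂ (L2 (-P.ℓ₁) 0 × H1Vanishing 0 P.ℓ₂ P.ℓ₂ × L2 0 P.ℓ₂ ×
    H1Vanishing 0 P.ℓ₂ P.ℓ₂ × L2 0 P.ℓ₂ × MemorySpace P))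

/-- The state `(z, v, V, p, Q, φ)`; `Q` is the velocity of `p`. -/
def mk (z : L2 (-P.ℓ₁) 0) (v : H1Vanishing 0 P.ℓ₂ P.ℓ₂) (V : L2 0 P.ℓ₂)
    (p : H1Vanishing 0 P.ℓ₂ P.ℓ₂) (Q : L2 0 P.ℓ₂) (φ : MemorySpace P) : EnergySpace P :=
  (z, v, V, p, Q, φ)

/-- The component `z`. -/
def z (U : EnergySpace P) : L2 (-P.ℓ₁) 0 := U.1

/-- The component `v`. -/
def v (U : EnergySpace P) : L2 0 P.ℓ₂ := U.2.1

/-- The component `V`. -/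
def V (U : EnergySpace P) : L2 0 P.ℓ₂ := U.2.2.1

/-- The component `p`. -/
def p (U : EnergySpace P) : L2 0 P.ℓ₂ := U.2.2.2.1

/-- The component `Q`, the velocity of `p`. -/
def Q (U : EnergySpace P) : L2 0 P.ℓ₂ := U.2.2.2.2.1

/-- The component `φ`. -/
def φ (U : EnergySpace P) : MemorySpace P := U.2.2.2.2.2

theorem v_mem (U : EnergySpace P) : U.v ∈ H1Vanishing 0 P.ℓ₂ P.ℓ₂ := U.2.1.2
theorem p_mem (U : EnergySpace P) : U.p ∈ H1Vanishing 0 P.ℓ₂ P.ℓ₂ := U.2.2.2.1.2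

@[simp] theorem add_z (U W : EnergySpace P) : (U + W).z = U.z + W.z := rfl
@[simp] theorem add_v (U W : EnergySpace P) : (U + W).v = U.v + W.v := rfl
@[simp] theorem add_V (U W : EnergySpace P) : (U + W).V = U.V + W.V := rfl
@[simp] theorem add_p (U W : EnergySpace P) : (U + W).p = U.p + W.p := rfl
@[simp] theorem add_Q (U W : EnergySpace P) : (U + W).Q = U.Q + W.Q := rfl
@[simp] theorem add_φ (U W : EnergySpace P) : (U + W).φ = U.φ + W.φ := rfl
@[simp] theorem smul_z (c : ℂ) (U : EnergySpace P) : (c • U).z = c • U.z := rfl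
@[simp] theorem smul_v (c : ℂ) (U : EnergySpace P) : (c • U).v = c • U.v := rfl
@[simp] theorem smul_V (c : ℂ) (U : EnergySpace P) : (c • U).V = c • U.V := rfl
@[simp] theorem smul_p (c : ℂ) (U : EnergySpace P) : (c • U).p = c • U.p := rfl
@[simp] theorem smul_Q (c : ℂ) (U : EnergySpace P) : (c • U).Q = c • U.Q := rfl
@[simp] theorem smul_φ (c : ℂ) (U : EnergySpace P) : (c • U).φ = c • U.φ := rfl
@[simp] theorem zero_z : (0 : EnergySpace P).z = 0 := rfl
@[simp] theorem zero_v : (0 : EnergySpace P).v = 0 := rfl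
@[simp] theorem zero_V : (0 : EnergySpace P).V = 0 := rfl
@[simp] theorem zero_p : (0 : EnergySpace P).p = 0 := rfl
@[simp] theorem zero_Q : (0 : EnergySpace P).Q = 0 := rfl
@[simp] theorem zero_φ : (0 : EnergySpace P).φ = 0 := rfl

theorem ext' {U W : EnergySpace P} (hz : U.z = W.z) (hv : U.v = W.v) (hV : U.V = W.V)
    (hp : U.p = W.p) (hQ : U.Q = W.Q) (hφ : U.φ = W.φ) : U = W :=
  Prod.ext hz (Prod.ext (Subtype.ext hv) (Prod.ext hV (Prod.ext (Subtype.ext hp)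
    (Prod.ext hQ hφ))))

/-- The inner product of the energy space (conjugate-linear in the first variable):
`⟨z,z̃⟩ + χ₁⟨v_x,ṽ_x⟩ + ρ⟨V,Ṽ⟩ + μ⟨Q,Q̃⟩ + β⟨γv_x - p_x, γṽ_x - p̃_x⟩ + 𝔠⟨φ,φ̃⟩`. -/
def energyInner (U W : EnergySpace P) : ℂ :=
  inner ℂ U.z W.z + P.χ₁ * inner ℂ (wderiv U.v) (wderiv W.v)
    + P.ρ * inner ℂ U.V W.V + P.μ * inner ℂ U.Q W.Q
    + P.β * inner ℂ ((P.γ : ℂ) • wderiv U.v - wderiv U.p) ((P.γ : ℂ) • wderiv W.v - wderiv W.p)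
    + P.𝔠 * inner ℂ U.φ W.φ

theorem re_energyInner_self (U : EnergySpace P) : (energyInner U U).re =
    ‖U.z‖ ^ 2 + P.χ₁ * ‖wderiv U.v‖ ^ 2 + P.ρ * ‖U.V‖ ^ 2 + P.μ * ‖U.Q‖ ^ 2
      + P.β * ‖(P.γ : ℂ) • wderiv U.v - wderiv U.p‖ ^ 2 + P.𝔠 * ‖U.φ‖ ^ 2 := by
  have h : energyInner U U = ((‖U.z‖ ^ 2 + P.χ₁ * ‖wderiv U.v‖ ^ 2 + P.ρ * ‖U.V‖ ^ 2
      + P.μ * ‖U.Q‖ ^ 2 + P.β * ‖(P.γ : ℂ) • wderiv U.v - wderiv U.p‖ ^ 2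
      + P.𝔠 * ‖U.φ‖ ^ 2 : ℝ) : ℂ) := by
    simp only [energyInner, inner_self_eq_norm_sq_to_K]
    push_cast
    rfl
  rw [h, Complex.ofReal_re]

/-- The energy inner product is an inner product. -/
abbrev core (P : Params) : InnerProductSpace.Core ℂ (EnergySpace P) where
  inner := energyInner
  conj_inner_symm U W := by
    simp only [energyInner, map_add, map_mul, inner_conj_symm, Complex.conj_ofReal]
  re_inner_nonneg U := by
    change 0 ≤ (energyInner U U).re
    rw [re_energyInner_self]
    have h1 : 0 < P.χ₁ := P.χ₁_pos
    have h2 := P.ρ_pos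
    have h3 := P.μ_pos
    have h4 := P.β_pos
    have h5 := P.𝔠_pos
    positivity
  add_left U W X := by
    simp only [energyInner, add_v, add_p, add_z, add_V, add_Q, add_φ,
      wderiv_add U.v_mem.1 W.v_mem.1, wderiv_add U.p_mem.1 W.p_mem.1, smul_add,
      add_sub_add_comm, inner_add_left]
    ring
  smul_left U W c := by
    simp only [energyInner, smul_v, smul_p, smul_z, smul_V, smul_Q, smul_φ,
      wderiv_smul c U.v_mem.1, wderiv_smul c U.p_mem.1, smul_comm (P.γ : ℂ) c,
      ← smul_sub, inner_smul_left]
    ring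
  definite U hU := by
    have h0 : (energyInner U U).re = 0 := by rw [show energyInner U U = 0 from hU]; rfl
    rw [re_energyInner_self] at h0
    have h1 : 0 < P.χ₁ := P.χ₁_pos
    have h2 := P.ρ_pos
    have h3 := P.μ_pos
    have h4 := P.β_pos
    have h5 := P.𝔠_pos
    have a1 : 0 ≤ ‖U.z‖ ^ 2 := by positivity
    have a2 : 0 ≤ P.χ₁ * ‖wderiv U.v‖ ^ 2 := by positivity
    have a3 : 0 ≤ P.ρ * ‖U.V‖ ^ 2 := by positivity
    have a4 : 0 ≤ P.μ * ‖U.Q‖ ^ 2 := by positivity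
    have a5 : 0 ≤ P.β * ‖(P.γ : ℂ) • wderiv U.v - wderiv U.p‖ ^ 2 := by positivity
    have a6 : 0 ≤ P.𝔠 * ‖U.φ‖ ^ 2 := by positivity
    have b1 : ‖U.z‖ ^ 2 = 0 := by linarith
    have b2 : P.χ₁ * ‖wderiv U.v‖ ^ 2 = 0 := by linarith
    have b3 : P.ρ * ‖U.V‖ ^ 2 = 0 := by linarith
    have b4 : P.μ * ‖U.Q‖ ^ 2 = 0 := by linarith
    have b5 : P.β * ‖(P.γ : ℂ) • wderiv U.v - wderiv U.p‖ ^ 2 = 0 := by linarith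
    have b6 : P.𝔠 * ‖U.φ‖ ^ 2 = 0 := by linarith
    have c1 : U.z = 0 := by simpa using b1
    have c2 : wderiv U.v = 0 := by simpa [h1.ne'] using b2
    have c3 : U.V = 0 := by simpa [h2.ne'] using b3
    have c4 : U.Q = 0 := by simpa [h3.ne'] using b4
    have c5 : wderiv U.p = 0 := by simpa [h4.ne', c2] using b5
    have c6 : U.φ = 0 := by simpa [h5.ne'] using b6
    have hm : P.ℓ₂ ∈ Icc 0 P.ℓ₂ := ⟨P.ℓ₂_pos.le, le_rfl⟩
    exact ext' c1 (eq_zero_of_wderiv_eq_zero P.ℓ₂_pos hm U.v_mem c2) c3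
      (eq_zero_of_wderiv_eq_zero P.ℓ₂_pos hm U.p_mem c5) c4 c6

instance : NormedAddCommGroup (EnergySpace P) := (core P).toNormedAddCommGroup

instance : InnerProductSpace ℂ (EnergySpace P) := InnerProductSpace.ofCore (core P).toCore

end EnergySpace

/-- The last component `-(ξ² + η) φ(ξ) + m(ξ) V` of `𝒜 (z, v, V, p, Q, φ)`, as a function
of `ξ` with values in `L²(0, ℓ₂)`. -/
def memoryRate {P : Params} (U : EnergySpace P) (ξ : ℝ) : L2 0 P.ℓ₂ :=
  -((ξ ^ 2 + P.η : ℝ) : ℂ) • U.φ ξ + (P.m ξ : ℂ) • U.V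

/-- The domain of the operator `𝒜`. -/
structure InDomain {P : Params} (U : EnergySpace P) : Prop where
  z_mem_H1 : U.z ∈ H1Vanishing (-P.ℓ₁) 0 (-P.ℓ₁)
  z_mem_H2 : U.z ∈ H2 (-P.ℓ₁) 0
  v_mem_H2 : U.v ∈ H2 0 P.ℓ₂
  p_mem_H2 : U.p ∈ H2 0 P.ℓ₂
  V_mem : U.V ∈ H1Vanishing 0 P.ℓ₂ P.ℓ₂
  Q_mem : U.Q ∈ H1Vanishing 0 P.ℓ₂ P.ℓ₂
  weight_memLp : MemLp (fun ξ : ℝ => ((|ξ| : ℝ) : ℂ) • U.φ ξ) 2 volume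
  rate_memLp : MemLp (memoryRate U) 2 volume
  /-- `z(0) = V(0)` -/
  velocity : ∃ c : ℂ, HasBoundaryValue U.z 0 c ∧ HasBoundaryValue U.V 0 c
  /-- `χ v_x(0) - γ β p_x(0) = κ z_x(0)` and `β p_x(0) = γ β v_x(0)` -/
  flux : ∃ zx vx px : ℂ, HasBoundaryValue (wderiv U.z) 0 zx ∧
    HasBoundaryValue (wderiv U.v) 0 vx ∧ HasBoundaryValue (wderiv U.p) 0 px ∧
    P.χ * vx - P.γ * P.β * px = P.κ * zx ∧ P.β * px = P.γ * P.β * vx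

section generator

variable {P : Params}

theorem memoryRate_add (U W : EnergySpace P) :
    memoryRate (U + W) =ᵐ[volume] memoryRate U + memoryRate W := by
  filter_upwards [Lp.coeFn_add U.φ W.φ] with ξ hξ
  simp only [memoryRate, EnergySpace.add_φ, EnergySpace.add_V, hξ, Pi.add_apply, smul_add]
  abel

theorem memoryRate_smul (c : ℂ) (U : EnergySpace P) :
    memoryRate (c • U) =ᵐ[volume] c • memoryRate U := by
  filter_upwards [Lp.coeFn_smul c U.φ] with ξ hξ
  simp only [memoryRate, EnergySpace.smul_φ, EnergySpace.smul_V, hξ, Pi.smul_apply, smul_add,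
    smul_comm c]

theorem memoryRate_zero : memoryRate (0 : EnergySpace P) =ᵐ[volume] 0 := by
  filter_upwards [Lp.coeFn_zero (L2 0 P.ℓ₂) 2 (volume : Measure ℝ)] with ξ hξ
  simp only [memoryRate, EnergySpace.zero_φ, EnergySpace.zero_V, hξ, Pi.zero_apply, smul_zero,
    add_zero]

theorem InDomain.add {U W : EnergySpace P} (hU : InDomain U) (hW : InDomain W) :
    InDomain (U + W) where
  z_mem_H1 := add_mem hU.z_mem_H1 hW.z_mem_H1
  z_mem_H2 := add_mem hU.z_mem_H2 hW.z_mem_H2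
  v_mem_H2 := add_mem hU.v_mem_H2 hW.v_mem_H2
  p_mem_H2 := add_mem hU.p_mem_H2 hW.p_mem_H2
  V_mem := add_mem hU.V_mem hW.V_mem
  Q_mem := add_mem hU.Q_mem hW.Q_mem
  weight_memLp := by
    refine (memLp_congr_ae ?_).2 (hU.weight_memLp.add hW.weight_memLp)
    filter_upwards [Lp.coeFn_add U.φ W.φ] with ξ hξ
    simp only [EnergySpace.add_φ, hξ, Pi.add_apply, smul_add]
  rate_memLp := (memLp_congr_ae (memoryRate_add U W)).2 (hU.rate_memLp.add hW.rate_memLp)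
  velocity := by
    obtain ⟨c, c1, c2⟩ := hU.velocity
    obtain ⟨d, d1, d2⟩ := hW.velocity
    exact ⟨c + d, c1.add d1, c2.add d2⟩
  flux := by
    obtain ⟨a, b, c, h1, h2, h3, h4, h5⟩ := hU.flux
    obtain ⟨a', b', c', h1', h2', h3', h4', h5'⟩ := hW.flux
    refine ⟨a + a', b + b', c + c', ?_, ?_, ?_, by linear_combination h4 + h4',
      by linear_combination h5 + h5'⟩
    · rw [EnergySpace.add_z, wderiv_add hU.z_mem_H2.1 hW.z_mem_H2.1]; exact h1.add h1'
    · rw [EnergySpace.add_v, wderiv_add hU.v_mem_H2.1 hW.v_mem_H2.1]; exact h2.add h2'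
    · rw [EnergySpace.add_p, wderiv_add hU.p_mem_H2.1 hW.p_mem_H2.1]; exact h3.add h3'

theorem InDomain.smul {U : EnergySpace P} (c : ℂ) (hU : InDomain U) : InDomain (c • U) where
  z_mem_H1 := Submodule.smul_mem _ c hU.z_mem_H1
  z_mem_H2 := Submodule.smul_mem _ c hU.z_mem_H2
  v_mem_H2 := Submodule.smul_mem _ c hU.v_mem_H2
  p_mem_H2 := Submodule.smul_mem _ c hU.p_mem_H2
  V_mem := Submodule.smul_mem _ c hU.V_mem
  Q_mem := Submodule.smul_mem _ c hU.Q_mem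
  weight_memLp := by
    refine (memLp_congr_ae ?_).2 (hU.weight_memLp.const_smul c)
    filter_upwards [Lp.coeFn_smul c U.φ] with ξ hξ
    simp only [EnergySpace.smul_φ, hξ, Pi.smul_apply, smul_comm c]
  rate_memLp := (memLp_congr_ae (memoryRate_smul c U)).2 (hU.rate_memLp.const_smul c)
  velocity := by
    obtain ⟨d, d1, d2⟩ := hU.velocity
    exact ⟨c * d, d1.smul c, d2.smul c⟩
  flux := by
    obtain ⟨x, y, w, h1, h2, h3, h4, h5⟩ := hU.flux
    refine ⟨c * x, c * y, c * w, ?_, ?_, ?_, by linear_combination c * h4,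
      by linear_combination c * h5⟩
    · rw [EnergySpace.smul_z, wderiv_smul c hU.z_mem_H2.1]; exact h1.smul c
    · rw [EnergySpace.smul_v, wderiv_smul c hU.v_mem_H2.1]; exact h2.smul c
    · rw [EnergySpace.smul_p, wderiv_smul c hU.p_mem_H2.1]; exact h3.smul c

theorem InDomain.zero : InDomain (0 : EnergySpace P) where
  z_mem_H1 := zero_mem _
  z_mem_H2 := zero_mem _
  v_mem_H2 := zero_mem _
  p_mem_H2 := zero_mem _
  V_mem := zero_mem _
  Q_mem := zero_mem _
  weight_memLp := by
    refine (memLp_congr_ae (g := 0) ?_).2 MemLp.zero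
    filter_upwards [Lp.coeFn_zero (L2 0 P.ℓ₂) 2 (volume : Measure ℝ)] with ξ hξ
    simp only [EnergySpace.zero_φ, hξ, Pi.zero_apply, smul_zero]
  rate_memLp := (memLp_congr_ae memoryRate_zero).2 MemLp.zero
  velocity := ⟨0, HasBoundaryValue.zero _, HasBoundaryValue.zero _⟩
  flux := by
    refine ⟨0, 0, 0, ?_, ?_, ?_, by simp, by simp⟩
    · rw [EnergySpace.zero_z, wderiv_zero]; exact HasBoundaryValue.zero _
    · rw [EnergySpace.zero_v, wderiv_zero]; exact HasBoundaryValue.zero _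
    · rw [EnergySpace.zero_p, wderiv_zero]; exact HasBoundaryValue.zero _

theorem Params.measurable_m (P : Params) : Measurable P.m :=
  (measurable_id.abs).pow_const _

theorem Params.m_sq (P : Params) (ξ : ℝ) : P.m ξ ^ 2 = |ξ| ^ (2 * P.α - 1) := by
  rw [Params.m, ← Real.rpow_natCast, ← Real.rpow_mul (abs_nonneg ξ)]
  congr 1
  push_cast
  ring

theorem Params.integrable_m_sq_div (P : Params) :
    Integrable (fun ξ : ℝ => P.m ξ ^ 2 / (1 + ξ ^ 2)) := by
  have hmeas : Measurable (fun ξ : ℝ => P.m ξ ^ 2 / (1 + ξ ^ 2)) :=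
    (P.measurable_m.pow_const 2).div (measurable_const.add (measurable_id.pow_const 2))
  have h1 : IntegrableOn (fun ξ : ℝ => P.m ξ ^ 2 / (1 + ξ ^ 2)) (Ioc 0 1) := by
    have := (intervalIntegral.intervalIntegrable_rpow' (a := 0) (b := 1)
      (r := 2 * P.α - 1) (by linarith [P.α_pos]))
    rw [intervalIntegrable_iff_integrableOn_Ioc_of_le zero_le_one] at this
    refine Integrable.mono' this hmeas.aestronglyMeasurable ?_
    filter_upwards [ae_restrict_mem measurableSet_Ioc] with ξ hξ
    rw [Real.norm_of_nonneg (by positivity), P.m_sq, abs_of_pos hξ.1]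
    exact div_le_self (Real.rpow_nonneg hξ.1.le _) (by nlinarith [sq_nonneg ξ])
  have h2 : IntegrableOn (fun ξ : ℝ => P.m ξ ^ 2 / (1 + ξ ^ 2)) (Ioi 1) := by
    have := integrableOn_Ioi_rpow_of_lt (a := 2 * P.α - 3) (c := 1)
      (by linarith [P.α_lt_one]) one_pos
    refine Integrable.mono' this hmeas.aestronglyMeasurable ?_
    filter_upwards [ae_restrict_mem measurableSet_Ioi] with ξ hξ
    have hξ0 : 0 < ξ := one_pos.trans hξ
    rw [Real.norm_of_nonneg (by positivity), P.m_sq, abs_of_pos hξ0,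
      div_le_iff₀ (by positivity)]
    have h3 : ξ ^ (2 * P.α - 1) = ξ ^ (2 * P.α - 3) * ξ ^ 2 := by
      rw [← Real.rpow_natCast, ← Real.rpow_add hξ0]
      congr 1
      push_cast
      ring
    rw [h3]
    exact mul_le_mul_of_nonneg_left (by linarith) (Real.rpow_nonneg hξ0.le _)
  have h3 : IntegrableOn (fun ξ : ℝ => P.m ξ ^ 2 / (1 + ξ ^ 2)) (Ioi 0) := by
    rw [← Ioc_union_Ioi_eq_Ioi zero_le_one]
    exact h1.union h2
  have h4 : IntegrableOn (fun ξ : ℝ => P.m ξ ^ 2 / (1 + ξ ^ 2)) (Iic 0) := by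
    have hn : MeasurableEmbedding fun x : ℝ => -x := (Homeomorph.neg ℝ).measurableEmbedding
    rw [← Measure.map_neg_eq_self (volume : Measure ℝ), hn.integrableOn_map_iff]
    simp only [Function.comp_def, Params.m, abs_neg, neg_preimage, neg_Iic, neg_zero, neg_sq]
    exact Iff.mpr integrableOn_Ici_iff_integrableOn_Ioi (by simpa only [Params.m] using h3)
  rw [← integrableOn_univ, ← Iic_union_Ioi (a := (0 : ℝ))]
  exact h4.union h3

/-- For states in the domain the integral of `m φ` over `ℝ` converges. -/
theorem InDomain.integrable {U : EnergySpace P} (hU : InDomain U) :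
    Integrable (fun ξ : ℝ => (P.m ξ : ℂ) • U.φ ξ) := by
  have h1 : Integrable (fun ξ : ℝ => ‖U.φ ξ‖ ^ 2) :=
    (memLp_two_iff_integrable_sq_norm (Lp.memLp U.φ).1).1 (Lp.memLp U.φ)
  have h2 : Integrable (fun ξ : ℝ => ‖((|ξ| : ℝ) : ℂ) • U.φ ξ‖ ^ 2) :=
    (memLp_two_iff_integrable_sq_norm hU.weight_memLp.1).1 hU.weight_memLp
  refine Integrable.mono' (P.integrable_m_sq_div.add (h1.add h2)) ?_ ?_
  · exact (Complex.measurable_ofReal.comp P.measurable_m).aestronglyMeasurable.smul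
      (Lp.memLp U.φ).1
  · refine Filter.Eventually.of_forall fun ξ => ?_
    have hm : 0 ≤ P.m ξ := Real.rpow_nonneg (abs_nonneg ξ) _
    simp only [Pi.add_apply, norm_smul, Complex.norm_real, Real.norm_eq_abs, abs_abs,
      abs_of_nonneg hm, mul_pow, sq_abs]
    set x := ‖U.φ ξ‖
    have hp : (0 : ℝ) < 1 + ξ ^ 2 := by positivity
    have e : P.m ξ ^ 2 / (1 + ξ ^ 2) + (x ^ 2 + ξ ^ 2 * x ^ 2) - 2 * (P.m ξ * x)
        = (P.m ξ - (1 + ξ ^ 2) * x) ^ 2 / (1 + ξ ^ 2) := by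
      field_simp
      ring
    have e2 : 0 ≤ (P.m ξ - (1 + ξ ^ 2) * x) ^ 2 / (1 + ξ ^ 2) := by positivity
    have e3 : 0 ≤ P.m ξ * x := mul_nonneg hm (norm_nonneg _)
    linarith

/-- The integral of `m φ` over `ℝ`, an element of `L²(0, ℓ₂)`. -/
def memoryForce (U : EnergySpace P) : L2 0 P.ℓ₂ := ∫ ξ : ℝ, (P.m ξ : ℂ) • U.φ ξ

theorem memoryForce_add {U W : EnergySpace P} (hU : InDomain U) (hW : InDomain W) :
    memoryForce (U + W) = memoryForce U + memoryForce W := by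
  rw [memoryForce, memoryForce, memoryForce, ← integral_add hU.integrable hW.integrable]
  refine integral_congr_ae ?_
  filter_upwards [Lp.coeFn_add U.φ W.φ] with ξ hξ
  simp only [EnergySpace.add_φ, hξ, Pi.add_apply, smul_add]

theorem memoryForce_smul (c : ℂ) (U : EnergySpace P) :
    memoryForce (c • U) = c • memoryForce U := by
  rw [memoryForce, memoryForce, ← integral_smul]
  refine integral_congr_ae ?_
  filter_upwards [Lp.coeFn_smul c U.φ] with ξ hξ
  simp only [EnergySpace.smul_φ, hξ, Pi.smul_apply, smul_comm c]

/-- The third component `ρ⁻¹ (χ v_xx - γ β p_xx - 𝔠 ∫ m(ξ) φ(ξ) dξ)` of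
`𝒜 (z, v, V, p, Q, φ)`. -/
def stretchRate (U : EnergySpace P) : L2 0 P.ℓ₂ :=
  (P.ρ : ℂ)⁻¹ • ((P.χ : ℂ) • wderiv (wderiv U.v) - (P.γ * P.β : ℂ) • wderiv (wderiv U.p)
    - (P.𝔠 : ℂ) • memoryForce U)

/-- The fifth component `μ⁻¹ (β p_xx - γ β v_xx)` of `𝒜 (z, v, V, p, Q, φ)`. -/
def chargeRate (U : EnergySpace P) : L2 0 P.ℓ₂ :=
  (P.μ : ℂ)⁻¹ • ((P.β : ℂ) • wderiv (wderiv U.p) - (P.γ * P.β : ℂ) • wderiv (wderiv U.v))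

theorem wderiv_wderiv_add {a b : ℝ} {u v : L2 a b} (hu : u ∈ H2 a b) (hv : v ∈ H2 a b) :
    wderiv (wderiv (u + v)) = wderiv (wderiv u) + wderiv (wderiv v) := by
  rw [wderiv_add hu.1 hv.1, wderiv_add hu.2 hv.2]

theorem wderiv_wderiv_smul {a b : ℝ} {u : L2 a b} (c : ℂ) (hu : u ∈ H2 a b) :
    wderiv (wderiv (c • u)) = c • wderiv (wderiv u) := by
  rw [wderiv_smul c hu.1, wderiv_smul c hu.2]

theorem stretchRate_add {U W : EnergySpace P} (hU : InDomain U) (hW : InDomain W) :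
    stretchRate (U + W) = stretchRate U + stretchRate W := by
  simp only [stretchRate, EnergySpace.add_v, EnergySpace.add_p,
    wderiv_wderiv_add hU.v_mem_H2 hW.v_mem_H2, wderiv_wderiv_add hU.p_mem_H2 hW.p_mem_H2,
    memoryForce_add hU hW, smul_add, smul_sub]
  abel

theorem stretchRate_smul {U : EnergySpace P} (c : ℂ) (hU : InDomain U) :
    stretchRate (c • U) = c • stretchRate U := by
  simp only [stretchRate, EnergySpace.smul_v, EnergySpace.smul_p,
    wderiv_wderiv_smul c hU.v_mem_H2, wderiv_wderiv_smul c hU.p_mem_H2,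
    memoryForce_smul, smul_sub, smul_comm c]

theorem chargeRate_add {U W : EnergySpace P} (hU : InDomain U) (hW : InDomain W) :
    chargeRate (U + W) = chargeRate U + chargeRate W := by
  simp only [chargeRate, EnergySpace.add_v, EnergySpace.add_p,
    wderiv_wderiv_add hU.v_mem_H2 hW.v_mem_H2, wderiv_wderiv_add hU.p_mem_H2 hW.p_mem_H2,
    smul_add, smul_sub]
  abel

theorem chargeRate_smul {U : EnergySpace P} (c : ℂ) (hU : InDomain U) :
    chargeRate (c • U) = c • chargeRate U := by
  simp only [chargeRate, EnergySpace.smul_v, EnergySpace.smul_p,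
    wderiv_wderiv_smul c hU.v_mem_H2, wderiv_wderiv_smul c hU.p_mem_H2,
    smul_sub, smul_comm c]

theorem heat_add {U W : EnergySpace P} (hU : InDomain U) (hW : InDomain W) :
    (P.κ : ℂ) • wderiv (wderiv (U + W).z)
      = (P.κ : ℂ) • wderiv (wderiv U.z) + (P.κ : ℂ) • wderiv (wderiv W.z) := by
  rw [EnergySpace.add_z, wderiv_wderiv_add hU.z_mem_H2 hW.z_mem_H2, smul_add]

theorem heat_smul {U : EnergySpace P} (c : ℂ) (hU : InDomain U) :
    (P.κ : ℂ) • wderiv (wderiv (c • U).z) = c • (P.κ : ℂ) • wderiv (wderiv U.z) := by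
  rw [EnergySpace.smul_z, wderiv_wderiv_smul c hU.z_mem_H2, smul_comm]

theorem rate_toLp_add {U W : EnergySpace P} (hU : InDomain U) (hW : InDomain W) :
    (hU.add hW).rate_memLp.toLp (memoryRate (U + W))
      = hU.rate_memLp.toLp (memoryRate U) + hW.rate_memLp.toLp (memoryRate W) := by
  rw [← MemLp.toLp_add]
  exact MemLp.toLp_congr _ _ (memoryRate_add U W)

theorem rate_toLp_smul {U : EnergySpace P} (c : ℂ) (hU : InDomain U) :
    (hU.smul c).rate_memLp.toLp (memoryRate (c • U))
      = c • hU.rate_memLp.toLp (memoryRate U) := by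
  rw [← MemLp.toLp_const_smul]
  exact MemLp.toLp_congr _ _ (memoryRate_smul c U)

/-- The value `𝒜 U = (κ z_xx, V, ρ⁻¹ (χ v_xx - γ β p_xx - 𝔠 ∫ m φ dξ), Q,
μ⁻¹ (β p_xx - γ β v_xx), -(ξ² + η) φ + m V)` for `U = (z, v, V, p, Q, φ)` in the domain. -/
def generatorFun (U : EnergySpace P) (hU : InDomain U) : EnergySpace P :=
  EnergySpace.mk ((P.κ : ℂ) • wderiv (wderiv U.z)) ⟨U.V, hU.V_mem⟩ (stretchRate U)
    ⟨U.Q, hU.Q_mem⟩ (chargeRate U) (hU.rate_memLp.toLp (memoryRate U))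

theorem generatorFun_add {U W : EnergySpace P} (hU : InDomain U) (hW : InDomain W) :
    generatorFun (U + W) (hU.add hW) = generatorFun U hU + generatorFun W hW := by
  refine EnergySpace.ext' ?_ ?_ ?_ ?_ ?_ ?_
  · rw [EnergySpace.add_z]; exact heat_add hU hW
  · rw [EnergySpace.add_v]; rfl
  · rw [EnergySpace.add_V]; exact stretchRate_add hU hW
  · rw [EnergySpace.add_p]; rfl
  · rw [EnergySpace.add_Q]; exact chargeRate_add hU hW
  · rw [EnergySpace.add_φ]; exact rate_toLp_add hU hW

theorem generatorFun_smul {U : EnergySpace P} (c : ℂ) (hU : InDomain U) :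
    generatorFun (c • U) (hU.smul c) = c • generatorFun U hU := by
  refine EnergySpace.ext' ?_ ?_ ?_ ?_ ?_ ?_
  · rw [EnergySpace.smul_z]; exact heat_smul c hU
  · rw [EnergySpace.smul_v]; rfl
  · rw [EnergySpace.smul_V]; exact stretchRate_smul c hU
  · rw [EnergySpace.smul_p]; rfl
  · rw [EnergySpace.smul_Q]; exact chargeRate_smul c hU
  · rw [EnergySpace.smul_φ]; exact rate_toLp_smul c hU

/-- The operator `𝒜 : D(𝒜) ⊆ ℋ → ℋ` in the energy space `ℋ`. -/
def generator (P : Params) : EnergySpace P →ₗ.[ℂ] EnergySpace P where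
  domain :=
    { carrier := {U | InDomain U}
      add_mem' := InDomain.add
      zero_mem' := InDomain.zero
      smul_mem' := fun c _ hU => InDomain.smul c hU }
  toFun :=
    { toFun := fun U => generatorFun U.1 U.2
      map_add' := fun U W => generatorFun_add U.2 W.2
      map_smul' := fun c U => generatorFun_smul c U.2 }

end generator

/-- The resolvent set of an unbounded operator `A` in a complex normed space: the set of all
`s ∈ ℂ` such that `s - A` maps the domain of `A` bijectively onto the space with a bounded
inverse. -/
def resolventSet {H : Type*} [NormedAddCommGroup H] [NormedSpace ℂ H] (A : H →ₗ.[ℂ] H) : Set ℂ :=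
  {s | ∃ R : H →L[ℂ] H,
    (∀ f : H, ∃ h : R f ∈ A.domain, s • R f - A ⟨R f, h⟩ = f) ∧
    ∀ u : A.domain, R (s • (u : H) - A u) = u}

end PiezoHeat

end

/-!
On the imaginary axis the resolvent equation `s U - 𝒜 U = f` is reduced to a compact perturbation
of the identity, so that by the Fredholm alternative it is enough to show that `𝒜` has no
eigenvalue there.

*Elimination.* The symbol `ξ² + η + s` is bounded below by a multiple of `1 + ξ²`, so the last
component is `φ = (f₆ + m V) / (ξ² + η + s)` (`memorySolution`), and its contribution to the
equation of `V` is a bounded operator of `f₆` plus the multiple `c(s) V`, where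
`c(s) = ∫ m² / (ξ² + η + s)` (`integral_memorySolution`). The velocities are `V = s v - f₂` and
`Q = s p - f₄`. What is left are three second-order equations on bounded intervals. They are
integrated once: the unknowns are `z_x`, `v_x`, `p_x - γ v_x` in `L²` and the number `z_x(0)`, and
the equations with the transmission conditions say that these are a fixed point of `reducedMap`,
which only involves primitives and boundary values. The state is recovered from its derivatives
(`ReducedData.state`), and it solves the resolvent equation
(`ReducedData.smul_state_sub_generatorFun`).

*Compactness.* The Volterra operator on `L²(a, b)` is a norm limit of operators of finite rank
(`isCompactOperator_volterra`), so `reducedMap` is compact. As the reduced problem is an equation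
between bounded operators, its inverse is bounded, and so is the resolvent.

*Injectivity.* If `𝒜 U = s U` with `s ∈ iℝ`, the real part of the energy identity reads
`κ ‖z_x‖² + 𝔠 Re c(s) ‖V‖² = 0` (`Eigen.dissipation_eq_zero`), and `Re c(s) > 0`. Hence `z = 0`,
`V = 0` and `φ = 0`, the stress `χ v_x - γ β p_x` is constant with value `κ z_x(0) = 0` at `0`, and
`v`, `p` vanish as well: for `s ≠ 0` because `v = V / s = 0` and `γ β ≠ 0`, for `s = 0` because
`β p_x - γ β v_x` is then zero too and `χ₁ ≠ 0`
(`Admissible.eq_zero_of_generatorFun_eq`).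
-/

noncomputable section

namespace PiezoHeat

section Interval

/-! ### Primitives in `L²(a, b)` -/

/-- Integration by parts for the primitives of two integrable functions, by Fubini. -/
theorem integral_mul_integral_Iic_add {μ : Measure ℝ} [SFinite μ] [NullSingletonClass μ]
    {f g : ℝ → ℂ} (hf : Integrable f μ) (hg : Integrable g μ) :
    ∫ x, f x * (∫ t in Iic x, g t ∂μ) ∂μ + ∫ x, (∫ t in Iic x, f t ∂μ) * g x ∂μ
      = (∫ x, f x ∂μ) * ∫ x, g x ∂μ := by
  have hA : MeasurableSet {p : ℝ × ℝ | p.1 ≤ p.2} :=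
    measurableSet_le measurable_fst measurable_snd
  have hB : MeasurableSet {p : ℝ × ℝ | p.2 ≤ p.1} :=
    measurableSet_le measurable_snd measurable_fst
  have hfg : Integrable (fun p : ℝ × ℝ => f p.1 * g p.2) (μ.prod μ) := hf.mul_prod hg
  have e1 : ∀ x, f x * (∫ t in Iic x, g t ∂μ)
      = ∫ t, indicator {p : ℝ × ℝ | p.2 ≤ p.1} (fun p => f p.1 * g p.2) (x, t) ∂μ := fun x => by
    rw [← integral_const_mul, ← integral_indicator measurableSet_Iic]
    rfl
  have e2 : ∀ x, (∫ t in Iic x, f t ∂μ) * g x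
      = ∫ t, indicator {p : ℝ × ℝ | p.1 ≤ p.2} (fun p => f p.1 * g p.2) (t, x) ∂μ := fun x => by
    rw [← integral_mul_const, ← integral_indicator measurableSet_Iic]
    rfl
  have i1 := (hfg.indicator hB).integral_prod_left
  have i2 := (hfg.indicator hA).integral_prod_left
  simp_rw [e1, e2]
  rw [← integral_integral_swap (f := fun x t =>
    indicator {p : ℝ × ℝ | p.1 ≤ p.2} (fun p => f p.1 * g p.2) (x, t)) (hfg.indicator hA),
    ← integral_add i1 i2, ← integral_mul_const]
  refine integral_congr_ae ?_
  filter_upwards [(hfg.indicator hB).prod_right_ae, (hfg.indicator hA).prod_right_ae]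
    with x h1 h2
  rw [← integral_add h1 h2, ← integral_const_mul]
  refine integral_congr_ae ?_
  filter_upwards [compl_mem_ae_iff.2 (measure_singleton (μ := μ) x)] with t ht
  rcases lt_or_gt_of_ne (show t ≠ x from ht) with h | h
  · simp [indicator, h.le, h.not_ge]
  · simp [indicator, h.le, h.not_ge]

variable {a b : ℝ}

theorem integrable_L2 (g : L2 a b) : Integrable g (volume.restrict (Ioo a b)) :=
  (Lp.memLp g).integrable (by norm_num)

/-- The bounded functional `g ↦ ∫_a^y g` on `L²(a, b)`. -/
def partialIntegral (a b y : ℝ) : L2 a b →L[ℂ] ℂ :=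
  innerSL ℂ (indicatorConstLp 2 (measurableSet_Iic (a := y)) (measure_ne_top _ _) (1 : ℂ))

theorem partialIntegral_apply (y : ℝ) (g : L2 a b) :
    partialIntegral a b y g = ∫ t in Iic y, g t ∂(volume.restrict (Ioo a b)) := by
  rw [partialIntegral, innerSL_apply_apply, L2.inner_indicatorConstLp_one]

/-- Primitives of square integrable functions are Hölder continuous of exponent `1 / 2`. -/
theorem norm_partialIntegral_sub_le (x y : ℝ) (g : L2 a b) :
    ‖partialIntegral a b x g - partialIntegral a b y g‖ ≤ √|x - y| * ‖g‖ := by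
  wlog hxy : y ≤ x generalizing x y
  · rw [norm_sub_rev, abs_sub_comm]
    exact this y x (le_of_not_ge hxy)
  have h1 : partialIntegral a b x g - partialIntegral a b y g
      = inner ℂ (indicatorConstLp 2 (measurableSet_Ioc (a := y) (b := x))
          (measure_ne_top (volume.restrict (Ioo a b)) _) (1 : ℂ)) g := by
    rw [partialIntegral_apply, partialIntegral_apply, L2.inner_indicatorConstLp_one,
      intervalIntegral.integral_Iic_sub_Iic (integrable_L2 g).integrableOn
        (integrable_L2 g).integrableOn, intervalIntegral.integral_of_le hxy]
  rw [h1]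
  refine (norm_inner_le_norm _ _).trans (mul_le_mul_of_nonneg_right ?_ (norm_nonneg _))
  rw [norm_indicatorConstLp (by norm_num) (by norm_num), norm_one, one_mul,
    ENNReal.toReal_ofNat, ← Real.sqrt_eq_rpow]
  refine Real.sqrt_le_sqrt ?_
  refine (ENNReal.toReal_mono (by simp) (Measure.restrict_apply_le _ _)).trans ?_
  rw [Real.volume_Ioc, ENNReal.toReal_ofReal (sub_nonneg.2 hxy)]
  exact le_abs_self _

theorem continuous_partialIntegral (g : L2 a b) :
    Continuous fun x => partialIntegral a b x g := by
  rw [continuous_iff_continuousAt]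
  intro y
  rw [ContinuousAt, tendsto_iff_norm_sub_tendsto_zero]
  refine squeeze_zero (fun _ => norm_nonneg _) (fun x => norm_partialIntegral_sub_le x y g) ?_
  have : Continuous fun x => √|x - y| * ‖g‖ := by fun_prop
  simpa using this.tendsto y

theorem partialIntegral_left (g : L2 a b) : partialIntegral a b a g = 0 := by
  have h : (volume.restrict (Ioo a b)).restrict (Iic a) = 0 := by
    rw [Measure.restrict_restrict measurableSet_Iic]
    have : Iic a ∩ Ioo a b = ∅ := by
      ext x; simp only [mem_inter_iff, mem_Iic, mem_Ioo, mem_empty_iff_false]; grind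
    rw [this, Measure.restrict_empty]
  rw [partialIntegral_apply, h, integral_zero_measure]

theorem partialIntegral_right (g : L2 a b) :
    partialIntegral a b b g = ∫ x in Ioo a b, g x := by
  rw [partialIntegral_apply, Measure.restrict_restrict measurableSet_Iic,
    inter_eq_right.2 fun x hx => hx.2.le]

theorem norm_partialIntegral_le (x : ℝ) (g : L2 a b) :
    ‖partialIntegral a b x g‖ ≤ (volume.restrict (Ioo a b)).real univ ^ (1 / 2 : ℝ) * ‖g‖ := by
  rw [partialIntegral, innerSL_apply_apply]
  refine (norm_inner_le_norm _ _).trans (mul_le_mul_of_nonneg_right ?_ (norm_nonneg _))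
  rw [norm_indicatorConstLp (by norm_num) (by norm_num), norm_one, one_mul, ENNReal.toReal_ofNat]
  exact Real.rpow_le_rpow (by positivity) (measureReal_mono (subset_univ _)) (by norm_num)

theorem memLp_partialIntegral (g : L2 a b) :
    MemLp (fun x => partialIntegral a b x g) 2 (volume.restrict (Ioo a b)) :=
  MemLp.of_bound (continuous_partialIntegral g).aestronglyMeasurable _
    (Filter.Eventually.of_forall fun x => norm_partialIntegral_le x g)

/-- The Volterra operator `g ↦ (x ↦ ∫_a^x g)` on `L²(a, b)`. -/
def volterra (a b : ℝ) : L2 a b →L[ℂ] L2 a b :=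
  LinearMap.mkContinuous
    { toFun := fun g => (memLp_partialIntegral g).toLp _
      map_add' := fun g h => by
        rw [← MemLp.toLp_add]
        exact MemLp.toLp_congr _ _ (Filter.Eventually.of_forall fun x => map_add _ g h)
      map_smul' := fun c g => by
        rw [RingHom.id_apply, ← MemLp.toLp_const_smul]
        exact MemLp.toLp_congr _ _ (Filter.Eventually.of_forall fun x => map_smul _ c g) }
    (measureUnivNNReal (volume.restrict (Ioo a b)) ^ (2 : ENNReal).toReal⁻¹ *
      (volume.restrict (Ioo a b)).real univ ^ (1 / 2 : ℝ))
    fun g => by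
      rw [mul_assoc]
      refine Lp.norm_le_of_ae_bound (by positivity) ?_
      filter_upwards [(memLp_partialIntegral g).coeFn_toLp] with x hx
      rw [LinearMap.coe_mk, AddHom.coe_mk, hx]
      exact norm_partialIntegral_le x g

theorem volterra_coeFn (g : L2 a b) :
    volterra a b g =ᵐ[volume.restrict (Ioo a b)] fun x => partialIntegral a b x g :=
  (memLp_partialIntegral g).coeFn_toLp

/-- The rounding of `x` down to the grid of mesh `1 / (n + 1)` changes `x` by at most the mesh. -/
theorem abs_sub_floor_div_le (n : ℕ) (x : ℝ) :
    |x - ⌊x * (n + 1)⌋ / (n + 1)| ≤ 1 / (n + 1) := by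
  have hn : (0 : ℝ) < n + 1 := by positivity
  have h1 := Int.floor_le (x * (n + 1))
  have h2 := Int.lt_floor_add_one (x * (n + 1))
  rw [show x - ⌊x * (n + 1)⌋ / (n + 1) = (x * (n + 1) - ⌊x * (n + 1)⌋) / (n + 1) by field_simp,
    abs_of_nonneg (div_nonneg (by linarith) hn.le)]
  gcongr
  linarith

/-- The Volterra operator is compact, as the norm limit of the finite-rank operators obtained by
rounding the upper limit of integration to a grid. -/
theorem isCompactOperator_volterra (a b : ℝ) : IsCompactOperator (volterra a b) := by
  -- The grid cells `A n k`, their indicator functions `χ n k`, and the finite set `I n` of the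
  -- cells that meet `(a, b)`.
  let A : ℕ → ℤ → Set ℝ := fun n k => {x | ⌊x * (n + 1)⌋ = k}
  have hA : ∀ n k, MeasurableSet (A n k) := fun n k =>
    (Int.measurable_floor.comp (measurable_id.mul_const _)) (measurableSet_singleton k)
  let χ : ℕ → ℤ → L2 a b := fun n k => indicatorConstLp 2 (hA n k) (measure_ne_top _ _) (1 : ℂ)
  let I : ℕ → Finset ℤ := fun n => Finset.Icc ⌊a * (n + 1)⌋ ⌊b * (n + 1)⌋
  let T : ℕ → L2 a b →L[ℂ] L2 a b := fun n =>
    ∑ k ∈ I n, (partialIntegral a b (k / (n + 1))).smulRight (χ n k)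
  have hT : ∀ n, IsCompactOperator (T n) := by
    intro n
    have h : ∀ k : ℤ, (partialIntegral a b (k / (n + 1))).smulRight (χ n k)
        ∈ compactOperator (RingHom.id ℂ) (L2 a b) (L2 a b) := fun k =>
      (isCompactOperator_of_locallyCompactSpace_dom (partialIntegral a b (k / (n + 1)))).clm_comp
        (ContinuousLinearMap.toSpanSingleton ℂ (χ n k))
    exact Submodule.sum_mem _ fun k _ => h k
  have hTx : ∀ n (g : L2 a b), ∀ᵐ x ∂(volume.restrict (Ioo a b)),
      T n g x = partialIntegral a b (⌊x * (n + 1)⌋ / (n + 1)) g := by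
    intro n g
    have e1 : T n g = ∑ k ∈ I n, partialIntegral a b (k / (n + 1)) g • χ n k := by
      simp [T]
    have e2 : ∀ᵐ x ∂(volume.restrict (Ioo a b)), ∀ k : ℤ,
        (partialIntegral a b (k / (n + 1)) g • χ n k : L2 a b) x
          = partialIntegral a b (k / (n + 1)) g • (A n k).indicator (fun _ => (1 : ℂ)) x := by
      rw [ae_all_iff]
      intro k
      filter_upwards [Lp.coeFn_smul (partialIntegral a b (k / (n + 1)) g) (χ n k),
        indicatorConstLp_coeFn (p := 2) (hs := hA n k)
          (hμs := measure_ne_top (volume.restrict (Ioo a b)) _) (c := (1 : ℂ))] with x h1 h2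
      rw [h1, Pi.smul_apply, h2]
    filter_upwards [e2, Lp.coeFn_fun_finsetSum (I n)
        (fun k : ℤ => partialIntegral a b (k / (n + 1)) g • χ n k),
      ae_restrict_mem measurableSet_Ioo] with x h2 h3 hx
    have hk : ⌊x * (n + 1)⌋ ∈ I n := by
      rw [Finset.mem_Icc]
      exact ⟨Int.floor_mono (by gcongr; exact hx.1.le), Int.floor_mono (by gcongr; exact hx.2.le)⟩
    rw [e1, h3, Finset.sum_eq_single_of_mem _ hk]
    · rw [h2, indicator_of_mem (show x ∈ A n ⌊x * (n + 1)⌋ from rfl), smul_eq_mul, mul_one]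
    · intro k _ hk'
      rw [h2, indicator_of_notMem (fun h : x ∈ A n k => hk' (Eq.symm h)), smul_zero]
  set C : ℝ := measureUnivNNReal (volume.restrict (Ioo a b)) ^ (2 : ENNReal).toReal⁻¹
  have hC : 0 ≤ C := by positivity
  have hle : ∀ n, ‖T n - volterra a b‖ ≤ C * √(1 / (n + 1)) := by
    intro n
    refine ContinuousLinearMap.opNorm_le_bound _ (by positivity) fun g => ?_
    rw [mul_assoc]
    refine Lp.norm_le_of_ae_bound (by positivity) ?_
    filter_upwards [hTx n g, volterra_coeFn g, Lp.coeFn_sub (T n g) (volterra a b g)]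
      with x h1 h2 h3
    rw [sub_apply, h3, Pi.sub_apply, h1, h2, norm_sub_rev]
    refine (norm_partialIntegral_sub_le _ _ g).trans ?_
    gcongr
    exact abs_sub_floor_div_le n x
  refine isCompactOperator_of_tendsto (l := Filter.atTop) (F := T) ?_
    (Filter.Eventually.of_forall hT)
  rw [tendsto_iff_norm_sub_tendsto_zero]
  refine squeeze_zero (fun _ => norm_nonneg _) hle ?_
  have h1 := (Real.continuous_sqrt.tendsto 0).comp
    (tendsto_one_div_add_atTop_nhds_zero_nat (𝕜 := ℝ))
  simpa using h1.const_mul C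

/-! ### Primitives, weak derivatives and integration by parts -/

/-- The constant function `1`, as an element of `L²(a, b)`. -/
def one (a b : ℝ) : L2 a b := Lp.const 2 _ 1

theorem one_coeFn : one a b =ᵐ[volume.restrict (Ioo a b)] fun _ => 1 := Lp.coeFn_const _ _ _

theorem hasBoundaryValue_one (y : ℝ) : HasBoundaryValue (one a b) y 1 :=
  ⟨fun _ => 1, continuousOn_const, one_coeFn, rfl⟩

theorem hasBoundaryValue_volterra (g : L2 a b) (y : ℝ) :
    HasBoundaryValue (volterra a b g) y (partialIntegral a b y g) :=
  ⟨_, (continuous_partialIntegral g).continuousOn, volterra_coeFn g, rfl⟩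

theorem setIntegral_Iic_deriv {ψ : ℝ → ℝ} (h1 : ContDiff ℝ ∞ ψ) (h2 : HasCompactSupport ψ)
    (h3 : tsupport ψ ⊆ Ioo a b) (x : ℝ) :
    ∫ t in Iic x, ((deriv ψ t : ℝ) : ℂ) ∂(volume.restrict (Ioo a b)) = ψ x := by
  rw [integral_complex_ofReal, Measure.restrict_restrict measurableSet_Iic,
    ← h2.integral_Iic_deriv_eq (h1.of_le (by simp)) x]
  congr 1
  symm
  refine setIntegral_eq_of_subset_of_forall_sdiff_eq_zero measurableSet_Iic inter_subset_left ?_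
  intro t ht
  have h4 : t ∉ Ioo a b := fun h => ht.2 ⟨ht.1, h⟩
  exact image_eq_zero_of_notMem_tsupport fun h => h4 (h3 (tsupport_deriv_subset h))

theorem integral_deriv_test {ψ : ℝ → ℝ} (h1 : ContDiff ℝ ∞ ψ) (h2 : HasCompactSupport ψ)
    (h3 : tsupport ψ ⊆ Ioo a b) :
    ∫ t in Ioo a b, ((deriv ψ t : ℝ) : ℂ) = 0 := by
  have h := setIntegral_Iic_deriv h1 h2 h3 b
  rw [Measure.restrict_restrict measurableSet_Iic, inter_eq_right.2 fun x hx => hx.2.le] at h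
  rw [h, image_eq_zero_of_notMem_tsupport fun hb => (h3 hb).2.ne rfl, Complex.ofReal_zero]

theorem hasWeakDeriv_one : HasWeakDeriv (one a b) 0 := by
  intro ψ h1 h2 h3
  have e1 : ∫ x in Ioo a b, deriv ψ x • one a b x = ∫ x in Ioo a b, ((deriv ψ x : ℝ) : ℂ) := by
    refine integral_congr_ae ?_
    filter_upwards [one_coeFn] with x hx
    rw [hx, Complex.real_smul, mul_one]
  have e2 : ∫ x in Ioo a b, ψ x • (0 : L2 a b) x = 0 := by
    refine integral_eq_zero_of_ae ?_
    filter_upwards [Lp.coeFn_zero ℂ 2 (volume.restrict (Ioo a b))] with x hx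
    rw [hx]
    exact smul_zero _
  rw [e1, e2, integral_deriv_test h1 h2 h3, neg_zero]

theorem hasWeakDeriv_volterra (g : L2 a b) : HasWeakDeriv (volterra a b g) g := by
  intro ψ h1 h2 h3
  have hd : Integrable (fun x => ((deriv ψ x : ℝ) : ℂ)) (volume.restrict (Ioo a b)) :=
    (((h1.continuous_deriv (by simp)).integrable_of_hasCompactSupport h2.deriv).ofReal).restrict
  have key := integral_mul_integral_Iic_add hd (integrable_L2 g)
  simp only [setIntegral_Iic_deriv h1 h2 h3] at key
  rw [integral_deriv_test h1 h2 h3, zero_mul] at key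
  rw [eq_neg_iff_add_eq_zero, ← key]
  congr 1
  · refine integral_congr_ae ?_
    filter_upwards [volterra_coeFn g] with x hx
    rw [hx, partialIntegral_apply, Complex.real_smul]

/-- The primitive of `g` that vanishes at `x₀`. -/
def primitive (a b x₀ : ℝ) : L2 a b →L[ℂ] L2 a b :=
  volterra a b - (partialIntegral a b x₀).smulRight (one a b)

theorem primitive_apply (x₀ : ℝ) (g : L2 a b) :
    primitive a b x₀ g = volterra a b g - partialIntegral a b x₀ g • one a b := rfl

theorem isCompactOperator_primitive (x₀ : ℝ) : IsCompactOperator (primitive a b x₀) := by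
  refine (isCompactOperator_volterra a b).sub ?_
  exact (isCompactOperator_of_locallyCompactSpace_dom (partialIntegral a b x₀)).clm_comp
    (ContinuousLinearMap.toSpanSingleton ℂ (one a b))

theorem HasWeakDeriv.sub {u v g h : L2 a b} (hu : HasWeakDeriv u g) (hv : HasWeakDeriv v h) :
    HasWeakDeriv (u - v) (g - h) := by
  have := hu.add (hv.smul (-1))
  rwa [neg_one_smul, neg_one_smul, ← sub_eq_add_neg, ← sub_eq_add_neg] at this

theorem HasBoundaryValue.sub {u v : L2 a b} {x₀ : ℝ} {c d : ℂ} (hu : HasBoundaryValue u x₀ c)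
    (hv : HasBoundaryValue v x₀ d) : HasBoundaryValue (u - v) x₀ (c - d) := by
  have := hu.add (hv.smul (-1))
  rwa [neg_one_smul, neg_one_mul, ← sub_eq_add_neg, ← sub_eq_add_neg] at this

theorem hasWeakDeriv_primitive (x₀ : ℝ) (g : L2 a b) : HasWeakDeriv (primitive a b x₀ g) g := by
  simpa [primitive_apply] using
    (hasWeakDeriv_volterra g).sub (hasWeakDeriv_one.smul (partialIntegral a b x₀ g))

theorem hasBoundaryValue_primitive (x₀ y : ℝ) (g : L2 a b) :
    HasBoundaryValue (primitive a b x₀ g) y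
      (partialIntegral a b y g - partialIntegral a b x₀ g) := by
  simpa [primitive_apply] using
    (hasBoundaryValue_volterra g y).sub ((hasBoundaryValue_one y).smul (partialIntegral a b x₀ g))

theorem wderiv_primitive (x₀ : ℝ) (g : L2 a b) : wderiv (primitive a b x₀ g) = g :=
  (hasWeakDeriv_primitive x₀ g).wderiv_eq

theorem primitive_mem_H1 (x₀ : ℝ) (g : L2 a b) : primitive a b x₀ g ∈ H1 a b :=
  ⟨g, hasWeakDeriv_primitive x₀ g⟩

theorem primitive_mem_H1Vanishing (x₀ : ℝ) (g : L2 a b) :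
    primitive a b x₀ g ∈ H1Vanishing a b x₀ :=
  ⟨primitive_mem_H1 x₀ g, by simpa using hasBoundaryValue_primitive x₀ x₀ g⟩

theorem primitive_wderiv {x₀ : ℝ} (hab : a < b) (hx₀ : x₀ ∈ Icc a b) {u : L2 a b}
    (hu : u ∈ H1Vanishing a b x₀) : primitive a b x₀ (wderiv u) = u := by
  have h := sub_mem (primitive_mem_H1Vanishing x₀ (wderiv u)) hu
  refine sub_eq_zero.1 (eq_zero_of_wderiv_eq_zero hab hx₀ h ?_)
  rw [((hasWeakDeriv_primitive x₀ (wderiv u)).sub (hasWeakDeriv_wderiv hu.1)).wderiv_eq, sub_self]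

/-- An element of `H¹(a, b)` is the primitive of its derivative, up to a constant. -/
theorem exists_eq_volterra_add (hab : a < b) {u : L2 a b} (hu : u ∈ H1 a b) :
    ∃ c : ℂ, u = volterra a b (wderiv u) + c • one a b := by
  have h := (hasWeakDeriv_wderiv hu).sub (hasWeakDeriv_volterra (wderiv u))
  rw [sub_self] at h
  obtain ⟨c, hc⟩ := h.ae_const hab
  refine ⟨c, ?_⟩
  rw [← sub_eq_iff_eq_add']
  refine Lp.ext ?_
  filter_upwards [hc, Lp.coeFn_smul c (one a b), one_coeFn] with x h1 h2 h3
  rw [h1, h2, Pi.smul_apply, h3, smul_eq_mul, mul_one]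

theorem exists_hasBoundaryValue (hab : a < b) {u : L2 a b} (hu : u ∈ H1 a b) (y : ℝ) :
    ∃ c : ℂ, HasBoundaryValue u y c := by
  obtain ⟨d, hd⟩ := exists_eq_volterra_add hab hu
  rw [hd]
  exact ⟨_, (hasBoundaryValue_volterra (wderiv u) y).add ((hasBoundaryValue_one y).smul d)⟩

theorem eq_volterra_add (hab : a < b) {u : L2 a b} (hu : u ∈ H1 a b) {c : ℂ}
    (hc : HasBoundaryValue u a c) : u = volterra a b (wderiv u) + c • one a b := by
  obtain ⟨d, hd⟩ := exists_eq_volterra_add hab hu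
  have h : HasBoundaryValue u a d := by
    rw [hd]
    simpa [partialIntegral_left] using
      (hasBoundaryValue_volterra (wderiv u) a).add ((hasBoundaryValue_one a).smul d)
  rwa [hc.unique hab ⟨le_rfl, hab.le⟩ h]

/-- Integration by parts in `H¹(a, b)`. -/
theorem inner_wderiv_add (hab : a < b) {u w : L2 a b} (hu : u ∈ H1 a b) (hw : w ∈ H1 a b)
    {ua ub wa wb : ℂ} (hua : HasBoundaryValue u a ua) (hub : HasBoundaryValue u b ub)
    (hwa : HasBoundaryValue w a wa) (hwb : HasBoundaryValue w b wb) :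
    inner ℂ (wderiv u) w + inner ℂ u (wderiv w) = conj ub * wb - conj ua * wa := by
  have coe : ∀ {u : L2 a b} {c : ℂ}, u ∈ H1 a b → HasBoundaryValue u a c →
      u =ᵐ[volume.restrict (Ioo a b)]
        fun x => (∫ t in Iic x, wderiv u t ∂(volume.restrict (Ioo a b))) + c := by
    intro u c hu hc
    have h := eq_volterra_add hab hu hc
    have h' : u =ᵐ[volume.restrict (Ioo a b)] (volterra a b (wderiv u) + c • one a b : L2 a b) := by
      rw [← h]
    filter_upwards [h', Lp.coeFn_add (volterra a b (wderiv u)) (c • one a b),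
      Lp.coeFn_smul c (one a b), one_coeFn (a := a) (b := b), volterra_coeFn (wderiv u)]
      with x h1 h2 h3 h4 h5
    rw [h1, h2, Pi.add_apply, h3, Pi.smul_apply, h4, h5, smul_eq_mul, mul_one,
      partialIntegral_apply]
  have bv : ∀ {u : L2 a b} {c d : ℂ}, u ∈ H1 a b → HasBoundaryValue u a c →
      HasBoundaryValue u b d → d = (∫ x in Ioo a b, wderiv u x) + c := by
    intro u c d hu hc hd
    have h1 := (hasBoundaryValue_volterra (wderiv u) b).add ((hasBoundaryValue_one b).smul c)
    rw [← eq_volterra_add hab hu hc, mul_one, partialIntegral_right] at h1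
    exact hd.unique hab ⟨hab.le, le_rfl⟩ h1
  have hf : Integrable (fun x => conj (wderiv u x)) (volume.restrict (Ioo a b)) :=
    Complex.conjCLE.toContinuousLinearMap.integrable_comp (integrable_L2 (wderiv u))
  have hg := integrable_L2 (wderiv w)
  have key := integral_mul_integral_Iic_add hf hg
  simp only [integral_conj] at key
  rw [bv hu hua hub, bv hw hwa hwb, L2.inner_def, L2.inner_def]
  have hb : ∀ g : L2 a b,
      AEStronglyMeasurable (fun x => ∫ t in Iic x, g t ∂(volume.restrict (Ioo a b)))
        (volume.restrict (Ioo a b)) ∧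
      ∀ᵐ x ∂(volume.restrict (Ioo a b)), ‖∫ t in Iic x, g t ∂(volume.restrict (Ioo a b))‖
        ≤ (volume.restrict (Ioo a b)).real univ ^ (1 / 2 : ℝ) * ‖g‖ := by
    intro g
    simp only [← partialIntegral_apply]
    exact ⟨(memLp_partialIntegral g).1,
      Filter.Eventually.of_forall fun x => norm_partialIntegral_le x g⟩
  have hb' : ∀ g : L2 a b,
      AEStronglyMeasurable (fun x => conj (∫ t in Iic x, g t ∂(volume.restrict (Ioo a b))))
        (volume.restrict (Ioo a b)) ∧
      ∀ᵐ x ∂(volume.restrict (Ioo a b)), ‖conj (∫ t in Iic x, g t ∂(volume.restrict (Ioo a b)))‖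
        ≤ (volume.restrict (Ioo a b)).real univ ^ (1 / 2 : ℝ) * ‖g‖ := by
    intro g
    simp only [RCLike.norm_conj]
    exact ⟨Complex.continuous_conj.comp_aestronglyMeasurable (hb g).1, (hb g).2⟩
  have e1 : ∫ x in Ioo a b, inner ℂ (wderiv u x) (w x)
      = (∫ x in Ioo a b, conj (wderiv u x) *
          ∫ t in Iic x, wderiv w t ∂(volume.restrict (Ioo a b)))
        + (∫ x in Ioo a b, conj (wderiv u x)) * wa := by
    rw [← integral_mul_const, ← integral_add (hf.mul_bdd (hb (wderiv w)).1 (hb (wderiv w)).2)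
      (hf.mul_const _)]
    refine integral_congr_ae ?_
    filter_upwards [coe hw hwa] with x hx
    rw [hx, RCLike.inner_apply]
    ring
  have e2 : ∫ x in Ioo a b, inner ℂ (u x) (wderiv w x)
      = (∫ x in Ioo a b, conj (∫ t in Iic x, wderiv u t ∂(volume.restrict (Ioo a b))) *
          wderiv w x)
        + conj ua * ∫ x in Ioo a b, wderiv w x := by
    rw [← integral_const_mul, ← integral_add (hg.bdd_mul (hb' (wderiv u)).1 (hb' (wderiv u)).2)
      (hg.const_mul _)]
    refine integral_congr_ae ?_
    filter_upwards [coe hu hua] with x hx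
    rw [hx, RCLike.inner_apply, map_add]
    ring
  rw [e1, e2, integral_conj]
  simp only [map_add]
  linear_combination key

end Interval

section System

variable {P : Params} {s : ℂ}

/-! ### The memory variable -/

/-- The spectral parameters treated below: `s ∈ iℝ`, with `s ≠ 0` in case `η = 0`. -/
structure Admissible (P : Params) (s : ℂ) : Prop where
  re_eq : s.re = 0
  nondegenerate : 0 < P.η ∨ s ≠ 0

/-- The symbol `ξ² + η + s` of the equation for the memory variable. -/
def symbol (P : Params) (s : ℂ) (ξ : ℝ) : ℂ := ((ξ ^ 2 + P.η : ℝ) : ℂ) + s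

theorem measurable_symbol : Measurable (symbol P s) := by
  have h : Measurable fun ξ : ℝ => ξ ^ 2 + P.η := by fun_prop
  exact (Complex.measurable_ofReal.comp h).add_const s

theorem Admissible.re_symbol (hs : Admissible P s) (ξ : ℝ) :
    (symbol P s ξ).re = ξ ^ 2 + P.η := by
  rw [symbol, Complex.add_re, hs.re_eq, Complex.ofReal_re, add_zero]

theorem Admissible.exists_le_norm_symbol (hs : Admissible P s) :
    ∃ δ : ℝ, 0 < δ ∧ ∀ ξ, δ * (1 + ξ ^ 2) ≤ ‖symbol P s ξ‖ := by
  have h0 : 0 < P.η + |s.im| := by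
    rcases hs.nondegenerate with h | h
    · positivity
    · have : s.im ≠ 0 := fun h' => h (Complex.ext hs.re_eq h')
      have := abs_pos.2 this
      linarith [P.η_nonneg]
  refine ⟨min 1 (P.η + |s.im|) / 2, by positivity, fun ξ => ?_⟩
  have h1 := Complex.abs_re_le_norm (symbol P s ξ)
  have h2 := Complex.abs_im_le_norm (symbol P s ξ)
  rw [hs.re_symbol, abs_of_nonneg (by have := P.η_nonneg; positivity)] at h1
  have h3 : (symbol P s ξ).im = s.im := by
    rw [symbol, Complex.add_im, Complex.ofReal_im, zero_add]
  rw [h3] at h2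
  have h4 := min_le_left 1 (P.η + |s.im|)
  have h5 := min_le_right 1 (P.η + |s.im|)
  nlinarith [sq_nonneg ξ, mul_le_mul_of_nonneg_right h4 (sq_nonneg ξ)]

theorem Admissible.symbol_ne_zero (hs : Admissible P s) (ξ : ℝ) : symbol P s ξ ≠ 0 := by
  obtain ⟨δ, hδ, h⟩ := hs.exists_le_norm_symbol
  exact norm_pos_iff.1 (lt_of_lt_of_le (by positivity) (h ξ))

theorem Params.m_nonneg (P : Params) (ξ : ℝ) : 0 ≤ P.m ξ := Real.rpow_nonneg (abs_nonneg ξ) _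

theorem Params.measurable_ofReal_m (P : Params) : Measurable fun ξ => (P.m ξ : ℂ) :=
  Complex.measurable_ofReal.comp P.measurable_m

/-- Division by the symbol gains the factor `1 + ξ²`. -/
theorem Admissible.memLp_top (hs : Admissible P s) {w : ℝ → ℂ} (hw : Measurable w)
    (h : ∀ ξ, ‖w ξ‖ ≤ 1 + ξ ^ 2) :
    MemLp (fun ξ => w ξ * (symbol P s ξ)⁻¹) ⊤ volume := by
  obtain ⟨δ, hδ, hle⟩ := hs.exists_le_norm_symbol
  refine memLp_top_of_bound (hw.mul measurable_symbol.inv).aestronglyMeasurable δ⁻¹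
    (Filter.Eventually.of_forall fun ξ => ?_)
  have h1 := norm_pos_iff.2 (hs.symbol_ne_zero ξ)
  rw [norm_mul, norm_inv, ← div_eq_mul_inv, div_le_iff₀ h1, inv_mul_eq_div, le_div_iff₀ hδ]
  exact le_trans (by rw [mul_comm]; gcongr; exact h ξ) (hle ξ)

theorem Admissible.memLp_two (hs : Admissible P s) {w : ℝ → ℂ} (hw : Measurable w)
    (h : ∀ ξ, ‖w ξ‖ ^ 2 ≤ P.m ξ ^ 2 * (1 + ξ ^ 2)) :
    MemLp (fun ξ => w ξ * (symbol P s ξ)⁻¹) 2 volume := by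
  obtain ⟨δ, hδ, hle⟩ := hs.exists_le_norm_symbol
  have hm : AEStronglyMeasurable (fun ξ => w ξ * (symbol P s ξ)⁻¹) volume :=
    (hw.mul measurable_symbol.inv).aestronglyMeasurable
  rw [memLp_two_iff_integrable_sq_norm hm]
  refine Integrable.mono' (P.integrable_m_sq_div.const_mul (δ ^ 2)⁻¹) (hm.norm.pow 2)
    (Filter.Eventually.of_forall fun ξ => ?_)
  have h1 := norm_pos_iff.2 (hs.symbol_ne_zero ξ)
  have h2 : (0 : ℝ) < 1 + ξ ^ 2 := by positivity
  rw [Real.norm_of_nonneg (by positivity), norm_mul, norm_inv, mul_pow, inv_pow]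
  have h3 : (δ * (1 + ξ ^ 2)) ^ 2 ≤ ‖symbol P s ξ‖ ^ 2 := by gcongr; exact hle ξ
  calc ‖w ξ‖ ^ 2 * (‖symbol P s ξ‖ ^ 2)⁻¹
      ≤ P.m ξ ^ 2 * (1 + ξ ^ 2) * ((δ * (1 + ξ ^ 2)) ^ 2)⁻¹ := by
        gcongr
        exact h ξ
    _ = (δ ^ 2)⁻¹ * (P.m ξ ^ 2 / (1 + ξ ^ 2)) := by field_simp

theorem Admissible.memLp_inv (hs : Admissible P s) :
    MemLp (fun ξ => (1 : ℂ) * (symbol P s ξ)⁻¹) ⊤ volume :=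
  hs.memLp_top measurable_const fun ξ => by simpa using sq_nonneg ξ

theorem Admissible.memLp_m (hs : Admissible P s) :
    MemLp (fun ξ => (P.m ξ : ℂ) * (symbol P s ξ)⁻¹) 2 volume :=
  hs.memLp_two P.measurable_ofReal_m fun ξ => by
    rw [Complex.norm_real, Real.norm_of_nonneg (P.m_nonneg ξ)]
    nlinarith [sq_nonneg ξ, mul_nonneg (sq_nonneg (P.m ξ)) (sq_nonneg ξ)]

theorem Admissible.integrable_m_sq (hs : Admissible P s) :
    Integrable fun ξ => ((P.m ξ ^ 2 : ℝ) : ℂ) * (symbol P s ξ)⁻¹ := by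
  obtain ⟨δ, hδ, hle⟩ := hs.exists_le_norm_symbol
  refine Integrable.mono' (P.integrable_m_sq_div.const_mul δ⁻¹)
    (((Complex.measurable_ofReal.comp (P.measurable_m.pow_const 2)).mul
      measurable_symbol.inv).aestronglyMeasurable) (Filter.Eventually.of_forall fun ξ => ?_)
  have h2 : (0 : ℝ) < 1 + ξ ^ 2 := by positivity
  rw [norm_mul, norm_inv, Complex.norm_real, Real.norm_of_nonneg (by positivity)]
  calc P.m ξ ^ 2 * ‖symbol P s ξ‖⁻¹ ≤ P.m ξ ^ 2 * (δ * (1 + ξ ^ 2))⁻¹ := by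
        gcongr
        exact hle ξ
    _ = δ⁻¹ * (P.m ξ ^ 2 / (1 + ξ ^ 2)) := by field_simp

/-- The coefficient `∫ m(ξ)² / (ξ² + η + s) dξ` of the memory term at the frequency `s`. -/
def memoryCoeff (P : Params) (s : ℂ) : ℂ := ∫ ξ, ((P.m ξ ^ 2 : ℝ) : ℂ) * (symbol P s ξ)⁻¹

/-- The memory term is strictly dissipative. -/
theorem Admissible.re_memoryCoeff_pos (hs : Admissible P s) : 0 < (memoryCoeff P s).re := by
  have h1 : (memoryCoeff P s).re = ∫ ξ, (((P.m ξ ^ 2 : ℝ) : ℂ) * (symbol P s ξ)⁻¹).re :=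
    (integral_re hs.integrable_m_sq).symm
  have h2 : ∀ ξ, (((P.m ξ ^ 2 : ℝ) : ℂ) * (symbol P s ξ)⁻¹).re
      = P.m ξ ^ 2 * ((ξ ^ 2 + P.η) / Complex.normSq (symbol P s ξ)) := fun ξ => by
    rw [Complex.re_ofReal_mul, Complex.inv_re, hs.re_symbol]
  have h3 : ∀ ξ, 0 ≤ P.m ξ ^ 2 * ((ξ ^ 2 + P.η) / Complex.normSq (symbol P s ξ)) := fun ξ =>
    mul_nonneg (sq_nonneg _) (div_nonneg (add_nonneg (sq_nonneg _) P.η_nonneg)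
      (Complex.normSq_nonneg _))
  have h4 := hs.integrable_m_sq.re
  simp only [RCLike.re_to_complex, h2] at h4
  rw [h1]
  simp only [h2]
  rw [integral_pos_iff_support_of_nonneg h3 h4]
  refine lt_of_lt_of_le ?_ (measure_mono (show Ioo (0 : ℝ) 1 ⊆ _ from fun ξ hξ => ?_))
  · rw [Real.volume_Ioo]; simp
  -- At `ξ = 0` the integrand may vanish, so positivity is read off on `(0, 1)`.
  · have h5 : 0 < P.m ξ := Real.rpow_pos_of_pos (abs_pos.2 hξ.1.ne') _
    have h6 := Complex.normSq_pos.2 (hs.symbol_ne_zero ξ)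
    have h7 : 0 < ξ ^ 2 + P.η := add_pos_of_pos_of_nonneg (pow_pos hξ.1 2) P.η_nonneg
    exact (show 0 < P.m ξ ^ 2 * ((ξ ^ 2 + P.η) / Complex.normSq (symbol P s ξ)) by positivity).ne'

/-- Division of the memory variable by the symbol. -/
def divSymbol (hs : Admissible P s) : MemorySpace P →L[ℂ] MemorySpace P :=
  (ContinuousLinearMap.lsmul ℂ ℂ).holderL volume ⊤ 2 2 (hs.memLp_inv.toLp _)

theorem divSymbol_coeFn (hs : Admissible P s) (f : MemorySpace P) :
    divSymbol hs f =ᵐ[volume] fun ξ => (symbol P s ξ)⁻¹ • f ξ := by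
  filter_upwards [(ContinuousLinearMap.lsmul ℂ ℂ).coeFn_holder (r := 2) (hs.memLp_inv.toLp _) f,
    hs.memLp_inv.coeFn_toLp] with ξ h1 h2
  rw [divSymbol]
  refine h1.trans ?_
  rw [h2, one_mul]; rfl

/-- The integral `∫ m(ξ) f(ξ) / (ξ² + η + s) dξ`. -/
def memoryPairing (hs : Admissible P s) : MemorySpace P →L[ℂ] L2 0 P.ℓ₂ :=
  (ContinuousLinearMap.lsmul ℂ ℂ).lpPairing volume 2 2 (hs.memLp_m.toLp _)

theorem memoryPairing_apply (hs : Admissible P s) (f : MemorySpace P) :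
    memoryPairing hs f = ∫ ξ, (P.m ξ : ℂ) • (symbol P s ξ)⁻¹ • f ξ := by
  rw [memoryPairing, ContinuousLinearMap.lpPairing_eq_integral]
  refine integral_congr_ae ?_
  filter_upwards [hs.memLp_m.coeFn_toLp] with ξ h
  rw [h, smul_smul]; rfl

/-- The memory variable `ξ ↦ m(ξ) V / (ξ² + η + s)` produced by the velocity `V`. -/
def memoryLift (hs : Admissible P s) : L2 0 P.ℓ₂ →L[ℂ] MemorySpace P :=
  LinearMap.mkContinuous
    { toFun := fun V => (ContinuousLinearMap.toSpanSingleton ℂ V).compLp (hs.memLp_m.toLp _)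
      map_add' := fun V W => by
        rw [← ContinuousLinearMap.add_compLp, ContinuousLinearMap.toSpanSingleton_add]
      map_smul' := fun c V => by
        rw [RingHom.id_apply, ← ContinuousLinearMap.smul_compLp,
          ContinuousLinearMap.toSpanSingleton_smul] }
    ‖hs.memLp_m.toLp _‖
    fun V => by
      refine (ContinuousLinearMap.norm_compLp_le _ _).trans ?_
      rw [ContinuousLinearMap.norm_toSpanSingleton, mul_comm]

theorem memoryLift_coeFn (hs : Admissible P s) (V : L2 0 P.ℓ₂) :
    memoryLift hs V =ᵐ[volume] fun ξ => ((P.m ξ : ℂ) * (symbol P s ξ)⁻¹) • V := by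
  filter_upwards [(ContinuousLinearMap.toSpanSingleton ℂ V).coeFn_compLp (hs.memLp_m.toLp _),
    hs.memLp_m.coeFn_toLp] with ξ h1 h2
  refine h1.trans ?_
  rw [h2]; rfl

/-- The solution `φ = (f + m V) / (ξ² + η + s)` of the equation of the memory variable. -/
def memorySolution (hs : Admissible P s) (f : MemorySpace P) (V : L2 0 P.ℓ₂) : MemorySpace P :=
  divSymbol hs f + memoryLift hs V

theorem memorySolution_coeFn (hs : Admissible P s) (f : MemorySpace P) (V : L2 0 P.ℓ₂) :
    memorySolution hs f V =ᵐ[volume]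
      fun ξ => (symbol P s ξ)⁻¹ • f ξ + ((P.m ξ : ℂ) * (symbol P s ξ)⁻¹) • V := by
  filter_upwards [divSymbol_coeFn hs f, memoryLift_coeFn hs V,
    Lp.coeFn_add (divSymbol hs f) (memoryLift hs V)] with ξ h1 h2 h3
  rw [memorySolution, h3, Pi.add_apply, h1, h2]

theorem memLp_weight_memorySolution (hs : Admissible P s) (f : MemorySpace P) (V : L2 0 P.ℓ₂) :
    MemLp (fun ξ : ℝ => ((|ξ| : ℝ) : ℂ) • memorySolution hs f V ξ) 2 volume := by
  have hm : Measurable fun ξ : ℝ => ((|ξ| : ℝ) : ℂ) :=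
    Complex.measurable_ofReal.comp measurable_id.abs
  have h1 : MemLp (fun ξ : ℝ => (((|ξ| : ℝ) : ℂ) * (symbol P s ξ)⁻¹) • f ξ) 2 volume :=
    (Lp.memLp f).smul (hs.memLp_top hm fun ξ => by
      rw [Complex.norm_real, Real.norm_of_nonneg (abs_nonneg ξ)]
      nlinarith [sq_nonneg (|ξ| - 1), sq_abs ξ, abs_nonneg ξ])
  have h2 : MemLp (fun ξ : ℝ => ((((|ξ| : ℝ) : ℂ) * (P.m ξ : ℂ)) * (symbol P s ξ)⁻¹) • V)
      2 volume := by
    have := hs.memLp_two (w := fun ξ => ((|ξ| : ℝ) : ℂ) * (P.m ξ : ℂ))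
      (hm.mul P.measurable_ofReal_m) fun ξ => by
        rw [norm_mul, Complex.norm_real, Complex.norm_real, Real.norm_of_nonneg (abs_nonneg ξ),
          Real.norm_of_nonneg (P.m_nonneg ξ), mul_pow, sq_abs]
        nlinarith [sq_nonneg (P.m ξ)]
    exact this.continuousLinearMap_comp (ContinuousLinearMap.toSpanSingleton ℂ V)
  refine (memLp_congr_ae ?_).2 (h1.add h2)
  filter_upwards [memorySolution_coeFn hs f V] with ξ h
  rw [h, Pi.add_apply, smul_add, smul_smul, smul_smul, mul_assoc]

/-- The memory force of the solution is a bounded function of the data and the velocity. -/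
theorem integral_memorySolution (hs : Admissible P s) (f : MemorySpace P) (V : L2 0 P.ℓ₂) :
    ∫ ξ, (P.m ξ : ℂ) • memorySolution hs f V ξ = memoryPairing hs f + memoryCoeff P s • V := by
  have h1 : Integrable fun ξ => (P.m ξ : ℂ) • (symbol P s ξ)⁻¹ • f ξ := by
    have := memLp_one_iff_integrable.1 ((Lp.memLp f).smul hs.memLp_m (r := 1))
    simp only [smul_smul]
    exact this
  have h2 : Integrable fun ξ => (((P.m ξ ^ 2 : ℝ) : ℂ) * (symbol P s ξ)⁻¹) • V :=
    hs.integrable_m_sq.smul_const V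
  rw [memoryPairing_apply, memoryCoeff, ← integral_smul_const, ← integral_add h1 h2]
  refine integral_congr_ae ?_
  filter_upwards [memorySolution_coeFn hs f V] with ξ h
  rw [h, smul_add, smul_smul _ _ V]
  congr 2
  push_cast
  ring

/-- The last component of the resolvent equation. -/
theorem rate_memorySolution (hs : Admissible P s) (f : MemorySpace P) (V : L2 0 P.ℓ₂) :
    (fun ξ => -((ξ ^ 2 + P.η : ℝ) : ℂ) • memorySolution hs f V ξ + (P.m ξ : ℂ) • V)
      =ᵐ[volume] (s • memorySolution hs f V - f : MemorySpace P) := by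
  filter_upwards [memorySolution_coeFn hs f V,
    Lp.coeFn_sub (s • memorySolution hs f V) f, Lp.coeFn_smul s (memorySolution hs f V)]
    with ξ h1 h2 h3
  rw [h2, Pi.sub_apply, h3, Pi.smul_apply]
  have h4 : symbol P s ξ • memorySolution hs f V ξ = f ξ + (P.m ξ : ℂ) • V := by
    rw [h1, smul_add, smul_smul, smul_smul, mul_left_comm,
      mul_inv_cancel₀ (hs.symbol_ne_zero ξ), one_smul, mul_one]
  rw [symbol, add_smul] at h4
  rw [neg_smul, ← sub_eq_zero, eq_sub_of_add_eq h4]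
  abel

/-- A memory variable in equilibrium with the velocity `V` at the frequency `s` is the one
produced by `V`. -/
theorem eq_memorySolution_zero (hs : Admissible P s) {φ : MemorySpace P} {V : L2 0 P.ℓ₂}
    (h : (fun ξ => -((ξ ^ 2 + P.η : ℝ) : ℂ) • φ ξ + (P.m ξ : ℂ) • V)
      =ᵐ[volume] (s • φ : MemorySpace P)) : φ = memorySolution hs 0 V := by
  refine Lp.ext ?_
  filter_upwards [h, memorySolution_coeFn hs 0 V, Lp.coeFn_smul s φ,
    Lp.coeFn_zero (L2 0 P.ℓ₂) 2 (volume : Measure ℝ)] with ξ h1 h2 h3 h4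
  rw [h3, Pi.smul_apply] at h1
  rw [h2, h4, Pi.zero_apply, smul_zero, zero_add, mul_comm, mul_smul]
  rw [eq_inv_smul_iff₀ (hs.symbol_ne_zero ξ), symbol, add_smul, ← h1, neg_smul]
  abel

/-! ### Coordinates on the energy space -/

theorem Params.ℓ₂_mem (P : Params) : P.ℓ₂ ∈ Icc 0 P.ℓ₂ := ⟨P.ℓ₂_pos.le, le_rfl⟩

namespace EnergySpace

theorem norm_sq_eq (U : EnergySpace P) : ‖U‖ ^ 2 =
    ‖U.z‖ ^ 2 + P.χ₁ * ‖wderiv U.v‖ ^ 2 + P.ρ * ‖U.V‖ ^ 2 + P.μ * ‖U.Q‖ ^ 2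
      + P.β * ‖(P.γ : ℂ) • wderiv U.v - wderiv U.p‖ ^ 2 + P.𝔠 * ‖U.φ‖ ^ 2 := by
  rw [← re_energyInner_self, ← inner_self_eq_norm_sq (𝕜 := ℂ)]
  rfl

/-- A coordinate of the energy space whose weighted square is bounded by the energy is a bounded
operator. -/
def coordL {E : Type*} [NormedAddCommGroup E] [NormedSpace ℂ E] (f : EnergySpace P →ₗ[ℂ] E)
    (c : ℝ) (hc : 0 < c) (h : ∀ U, c * ‖f U‖ ^ 2 ≤ ‖U‖ ^ 2) : EnergySpace P →L[ℂ] E :=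
  f.mkContinuous (√c)⁻¹ fun U => by
    rw [← div_eq_inv_mul, le_div_iff₀ (Real.sqrt_pos.2 hc)]
    refine abs_le_of_sq_le_sq' ?_ (norm_nonneg _) |>.2
    rw [mul_pow, Real.sq_sqrt hc.le, mul_comm]
    exact h U

theorem energy_terms_le (U : EnergySpace P) :
    1 * ‖U.z‖ ^ 2 ≤ ‖U‖ ^ 2 ∧ P.χ₁ * ‖wderiv U.v‖ ^ 2 ≤ ‖U‖ ^ 2 ∧ P.ρ * ‖U.V‖ ^ 2 ≤ ‖U‖ ^ 2 ∧
      P.μ * ‖U.Q‖ ^ 2 ≤ ‖U‖ ^ 2 ∧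
      P.β * ‖(P.γ : ℂ) • wderiv U.v - wderiv U.p‖ ^ 2 ≤ ‖U‖ ^ 2 ∧
      P.𝔠 * ‖U.φ‖ ^ 2 ≤ ‖U‖ ^ 2 := by
  have h1 : 0 < P.χ₁ := P.χ₁_pos
  have h2 := P.ρ_pos
  have h3 := P.μ_pos
  have h4 := P.β_pos
  have h5 := P.𝔠_pos
  have a1 : 0 ≤ ‖U.z‖ ^ 2 := by positivity
  have a2 : 0 ≤ P.χ₁ * ‖wderiv U.v‖ ^ 2 := by positivity
  have a3 : 0 ≤ P.ρ * ‖U.V‖ ^ 2 := by positivity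
  have a4 : 0 ≤ P.μ * ‖U.Q‖ ^ 2 := by positivity
  have a5 : 0 ≤ P.β * ‖(P.γ : ℂ) • wderiv U.v - wderiv U.p‖ ^ 2 := by positivity
  have a6 : 0 ≤ P.𝔠 * ‖U.φ‖ ^ 2 := by positivity
  rw [norm_sq_eq]
  refine ⟨?_, ?_, ?_, ?_, ?_, ?_⟩ <;> linarith

/-- The component `z` as a bounded operator. -/
def zL (P : Params) : EnergySpace P →L[ℂ] L2 (-P.ℓ₁) 0 :=
  coordL { toFun := z, map_add' := add_z, map_smul' := smul_z } 1 one_pos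
    fun U => (energy_terms_le U).1

/-- The derivative of the component `v` as a bounded operator. -/
def vxL (P : Params) : EnergySpace P →L[ℂ] L2 0 P.ℓ₂ :=
  coordL
    { toFun := fun U => wderiv U.v
      map_add' := fun U W => wderiv_add U.v_mem.1 W.v_mem.1
      map_smul' := fun c U => wderiv_smul c U.v_mem.1 } P.χ₁ P.χ₁_pos
    fun U => (energy_terms_le U).2.1

/-- The component `V` as a bounded operator. -/
def VL (P : Params) : EnergySpace P →L[ℂ] L2 0 P.ℓ₂ :=
  coordL { toFun := V, map_add' := add_V, map_smul' := smul_V } P.ρ P.ρ_pos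
    fun U => (energy_terms_le U).2.2.1

/-- The component `Q` as a bounded operator. -/
def QL (P : Params) : EnergySpace P →L[ℂ] L2 0 P.ℓ₂ :=
  coordL { toFun := Q, map_add' := add_Q, map_smul' := smul_Q } P.μ P.μ_pos
    fun U => (energy_terms_le U).2.2.2.1

/-- The combination `γ v_x - p_x` as a bounded operator. -/
def couplingL (P : Params) : EnergySpace P →L[ℂ] L2 0 P.ℓ₂ :=
  coordL
    { toFun := fun U => (P.γ : ℂ) • wderiv U.v - wderiv U.p
      map_add' := fun U W => by
        rw [add_v, add_p, wderiv_add U.v_mem.1 W.v_mem.1, wderiv_add U.p_mem.1 W.p_mem.1,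
          smul_add, add_sub_add_comm]
      map_smul' := fun c U => by
        rw [smul_v, smul_p, wderiv_smul c U.v_mem.1, wderiv_smul c U.p_mem.1,
          smul_comm (P.γ : ℂ) c, smul_sub, RingHom.id_apply] } P.β P.β_pos
    fun U => (energy_terms_le U).2.2.2.2.1

/-- The component `φ` as a bounded operator. -/
def φL (P : Params) : EnergySpace P →L[ℂ] MemorySpace P :=
  coordL { toFun := φ, map_add' := add_φ, map_smul' := smul_φ } P.𝔠 P.𝔠_pos
    fun U => (energy_terms_le U).2.2.2.2.2

/-- The derivative of the component `p` as a bounded operator. -/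
def pxL (P : Params) : EnergySpace P →L[ℂ] L2 0 P.ℓ₂ := (P.γ : ℂ) • vxL P - couplingL P

theorem pxL_apply (U : EnergySpace P) : pxL P U = wderiv U.p :=
  sub_sub_cancel ((P.γ : ℂ) • wderiv U.v) (wderiv U.p)

theorem primitive_vxL (U : EnergySpace P) : primitive 0 P.ℓ₂ P.ℓ₂ (vxL P U) = U.v :=
  primitive_wderiv P.ℓ₂_pos P.ℓ₂_mem U.v_mem

theorem primitive_pxL (U : EnergySpace P) : primitive 0 P.ℓ₂ P.ℓ₂ (pxL P U) = U.p := by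
  rw [pxL_apply]
  exact primitive_wderiv P.ℓ₂_pos P.ℓ₂_mem U.p_mem

/-- The state with given components `z`, `V`, `Q`, `φ` and given derivatives `v_x`, `p_x`. -/
def ofDeriv (z : L2 (-P.ℓ₁) 0) (vx V px Q : L2 0 P.ℓ₂) (φ : MemorySpace P) : EnergySpace P :=
  mk z ⟨primitive 0 P.ℓ₂ P.ℓ₂ vx, primitive_mem_H1Vanishing _ _⟩ V
    ⟨primitive 0 P.ℓ₂ P.ℓ₂ px, primitive_mem_H1Vanishing _ _⟩ Q φ

section

variable (z z' : L2 (-P.ℓ₁) 0) (vx V px Q vx' V' px' Q' : L2 0 P.ℓ₂) (φ φ' : MemorySpace P) (c : ℂ)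

theorem ofDeriv_z : (ofDeriv z vx V px Q φ).z = z := rfl
theorem ofDeriv_v : (ofDeriv z vx V px Q φ).v = primitive 0 P.ℓ₂ P.ℓ₂ vx := rfl
theorem ofDeriv_V : (ofDeriv z vx V px Q φ).V = V := rfl
theorem ofDeriv_p : (ofDeriv z vx V px Q φ).p = primitive 0 P.ℓ₂ P.ℓ₂ px := rfl
theorem ofDeriv_Q : (ofDeriv z vx V px Q φ).Q = Q := rfl
theorem ofDeriv_φ : (ofDeriv z vx V px Q φ).φ = φ := rfl

theorem ofDeriv_add : ofDeriv (z + z') (vx + vx') (V + V') (px + px') (Q + Q') (φ + φ')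
    = ofDeriv z vx V px Q φ + ofDeriv z' vx' V' px' Q' φ' := by
  refine ext' ?_ ?_ ?_ ?_ ?_ ?_
  · rw [add_z, ofDeriv_z, ofDeriv_z, ofDeriv_z]
  · rw [add_v, ofDeriv_v, ofDeriv_v, ofDeriv_v, map_add]
  · rw [add_V, ofDeriv_V, ofDeriv_V, ofDeriv_V]
  · rw [add_p, ofDeriv_p, ofDeriv_p, ofDeriv_p, map_add]
  · rw [add_Q, ofDeriv_Q, ofDeriv_Q, ofDeriv_Q]
  · rw [add_φ, ofDeriv_φ, ofDeriv_φ, ofDeriv_φ]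

theorem ofDeriv_smul : ofDeriv (c • z) (c • vx) (c • V) (c • px) (c • Q) (c • φ)
    = c • ofDeriv z vx V px Q φ := by
  refine ext' ?_ ?_ ?_ ?_ ?_ ?_
  · rw [smul_z, ofDeriv_z, ofDeriv_z]
  · rw [smul_v, ofDeriv_v, ofDeriv_v, map_smul]
  · rw [smul_V, ofDeriv_V, ofDeriv_V]
  · rw [smul_p, ofDeriv_p, ofDeriv_p, map_smul]
  · rw [smul_Q, ofDeriv_Q, ofDeriv_Q]
  · rw [smul_φ, ofDeriv_φ, ofDeriv_φ]

end

theorem norm_ofDeriv_le (z : L2 (-P.ℓ₁) 0) (vx V px Q : L2 0 P.ℓ₂) (φ : MemorySpace P) {r : ℝ}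
    (hz : ‖z‖ ≤ r) (hvx : ‖vx‖ ≤ r) (hV : ‖V‖ ≤ r) (hpx : ‖px‖ ≤ r) (hQ : ‖Q‖ ≤ r)
    (hφ : ‖φ‖ ≤ r) :
    ‖ofDeriv z vx V px Q φ‖
      ≤ √(1 + P.χ₁ + P.ρ + P.μ + P.β * (|P.γ| + 1) ^ 2 + P.𝔠) * r := by
  have h1 : 0 < P.χ₁ := P.χ₁_pos
  have h2 := P.ρ_pos
  have h3 := P.μ_pos
  have h4 := P.β_pos
  have h5 := P.𝔠_pos
  have hr : 0 ≤ r := (norm_nonneg z).trans hz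
  refine abs_le_of_sq_le_sq' ?_ (by positivity) |>.2
  have h6 : ‖(P.γ : ℂ) • vx - px‖ ≤ (|P.γ| + 1) * r := by
    refine (norm_sub_le _ _).trans ?_
    rw [norm_smul, Complex.norm_real, Real.norm_eq_abs, add_mul, one_mul]
    gcongr
  rw [norm_sq_eq, mul_pow, Real.sq_sqrt (by positivity)]
  change ‖z‖ ^ 2 + P.χ₁ * ‖wderiv (primitive 0 P.ℓ₂ P.ℓ₂ vx)‖ ^ 2 + P.ρ * ‖V‖ ^ 2 + P.μ * ‖Q‖ ^ 2
    + P.β * ‖(P.γ : ℂ) • wderiv (primitive 0 P.ℓ₂ P.ℓ₂ vx)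
      - wderiv (primitive 0 P.ℓ₂ P.ℓ₂ px)‖ ^ 2 + P.𝔠 * ‖φ‖ ^ 2 ≤ _
  rw [wderiv_primitive, wderiv_primitive]
  calc _ ≤ r ^ 2 + P.χ₁ * r ^ 2 + P.ρ * r ^ 2 + P.μ * r ^ 2 + P.β * ((|P.γ| + 1) * r) ^ 2
        + P.𝔠 * r ^ 2 := by gcongr
    _ = _ := by ring

/-- The inverse of the coordinate map `U ↦ (z, v_x, V, p_x, Q, φ)`. -/
def ofDerivL (P : Params) :
    L2 (-P.ℓ₁) 0 × L2 0 P.ℓ₂ × L2 0 P.ℓ₂ × L2 0 P.ℓ₂ × L2 0 P.ℓ₂ × MemorySpace P →L[ℂ]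
      EnergySpace P :=
  LinearMap.mkContinuous
    { toFun := fun Y => ofDeriv Y.1 Y.2.1 Y.2.2.1 Y.2.2.2.1 Y.2.2.2.2.1 Y.2.2.2.2.2
      map_add' := fun Y Z => by
        simp only [Prod.fst_add, Prod.snd_add]
        exact ofDeriv_add _ _ _ _ _ _ _ _ _ _ _ _
      map_smul' := fun c Y => by
        simp only [Prod.smul_fst, Prod.smul_snd, RingHom.id_apply]
        exact ofDeriv_smul _ _ _ _ _ _ _ }
    (√(1 + P.χ₁ + P.ρ + P.μ + P.β * (|P.γ| + 1) ^ 2 + P.𝔠))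
    fun Y => by
      have h2 := norm_snd_le Y
      have h3 := (norm_snd_le Y.2).trans h2
      have h4 := (norm_snd_le Y.2.2).trans h3
      have h5 := (norm_snd_le Y.2.2.2).trans h4
      exact norm_ofDeriv_le _ _ _ _ _ _ (norm_fst_le Y) ((norm_fst_le Y.2).trans h2)
        ((norm_fst_le Y.2.2).trans h3) ((norm_fst_le Y.2.2.2).trans h4)
        ((norm_fst_le Y.2.2.2.2).trans h5) ((norm_snd_le Y.2.2.2.2).trans h5)

end EnergySpace

/-! ### Absence of eigenvalues on the imaginary axis -/

theorem memorySolution_zero (hs : Admissible P s) : memorySolution hs 0 0 = 0 := by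
  rw [memorySolution, map_zero, map_zero, add_zero]

/-- The components of the equation `𝒜 U = s U`; the two second-order equations of the beam are
written for the fluxes `χ v_x - γ β p_x` and `β p_x - γ β v_x`. -/
structure Eigen (P : Params) (s : ℂ) (U : EnergySpace P) : Prop where
  mem : InDomain U
  heat : (P.κ : ℂ) • wderiv (wderiv U.z) = s • U.z
  velocity : U.V = s • U.v
  stretch : wderiv ((P.χ : ℂ) • wderiv U.v - (P.γ * P.β : ℂ) • wderiv U.p)
    = (P.ρ * s + P.𝔠 * memoryCoeff P s) • U.V
  current : U.Q = s • U.p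
  charge : wderiv ((P.β : ℂ) • wderiv U.p - (P.γ * P.β : ℂ) • wderiv U.v) = (P.μ * s) • U.Q

theorem wderiv_sub {a b : ℝ} {u v : L2 a b} (hu : u ∈ H1 a b) (hv : v ∈ H1 a b) :
    wderiv (u - v) = wderiv u - wderiv v :=
  ((hasWeakDeriv_wderiv hu).sub (hasWeakDeriv_wderiv hv)).wderiv_eq

theorem wderiv_stretch {U : EnergySpace P} (hU : InDomain U) :
    wderiv ((P.χ : ℂ) • wderiv U.v - (P.γ * P.β : ℂ) • wderiv U.p)
      = (P.χ : ℂ) • wderiv (wderiv U.v) - (P.γ * P.β : ℂ) • wderiv (wderiv U.p) := by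
  rw [wderiv_sub (Submodule.smul_mem _ _ hU.v_mem_H2.2) (Submodule.smul_mem _ _ hU.p_mem_H2.2),
    wderiv_smul _ hU.v_mem_H2.2, wderiv_smul _ hU.p_mem_H2.2]

theorem wderiv_charge {U : EnergySpace P} (hU : InDomain U) :
    wderiv ((P.β : ℂ) • wderiv U.p - (P.γ * P.β : ℂ) • wderiv U.v)
      = (P.β : ℂ) • wderiv (wderiv U.p) - (P.γ * P.β : ℂ) • wderiv (wderiv U.v) := by
  rw [wderiv_sub (Submodule.smul_mem _ _ hU.p_mem_H2.2) (Submodule.smul_mem _ _ hU.v_mem_H2.2),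
    wderiv_smul _ hU.v_mem_H2.2, wderiv_smul _ hU.p_mem_H2.2]

theorem Admissible.φ_eq (hs : Admissible P s) {U : EnergySpace P} (hU : InDomain U)
    (h : generatorFun U hU = s • U) : U.φ = memorySolution hs 0 U.V := by
  refine eq_memorySolution_zero hs ?_
  have h6 : hU.rate_memLp.toLp (memoryRate U) = s • U.φ := congrArg EnergySpace.φ h
  rw [← h6]
  exact hU.rate_memLp.coeFn_toLp.symm

theorem Admissible.eigen (hs : Admissible P s) {U : EnergySpace P} (hU : InDomain U)
    (h : generatorFun U hU = s • U) : Eigen P s U := by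
  have hρ : (P.ρ : ℂ) ≠ 0 := Complex.ofReal_ne_zero.2 P.ρ_pos.ne'
  have hμ : (P.μ : ℂ) ≠ 0 := Complex.ofReal_ne_zero.2 P.μ_pos.ne'
  have hF : memoryForce U = memoryCoeff P s • U.V := by
    rw [memoryForce, hs.φ_eq hU h, integral_memorySolution, map_zero, zero_add]
  have h3 : stretchRate U = s • U.V := congrArg EnergySpace.V h
  have h5 : chargeRate U = s • U.Q := congrArg EnergySpace.Q h
  rw [stretchRate, inv_smul_eq_iff₀ hρ, sub_eq_iff_eq_add, hF] at h3
  rw [chargeRate, inv_smul_eq_iff₀ hμ] at h5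
  refine ⟨hU, congrArg EnergySpace.z h, congrArg EnergySpace.v h, ?_, congrArg EnergySpace.p h, ?_⟩
  · rw [wderiv_stretch hU, h3, smul_smul, smul_smul, ← add_smul]
  · rw [wderiv_charge hU, h5, smul_smul]

/-- The real part of the energy identity: heat conduction and memory are the only sources of
dissipation, and an eigenvector for an imaginary eigenvalue dissipates nothing. -/
theorem Eigen.dissipation_eq_zero (hs : Admissible P s) {U : EnergySpace P} (hU : Eigen P s U) :
    P.κ * ‖wderiv U.z‖ ^ 2 + P.𝔠 * (memoryCoeff P s).re * ‖U.V‖ ^ 2 = 0 := by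
  obtain ⟨z0, hz0, hV0⟩ := hU.mem.velocity
  obtain ⟨zx, vx, px, hzx, hvx, hpx, f1, f2⟩ := hU.mem.flux
  have hℓ₁ : -P.ℓ₁ < 0 := neg_lt_zero.2 P.ℓ₁_pos
  obtain ⟨zl, hzl⟩ := exists_hasBoundaryValue hℓ₁ hU.mem.z_mem_H2.2 (-P.ℓ₁)
  have m1 := sub_mem (Submodule.smul_mem _ (P.χ : ℂ) hU.mem.v_mem_H2.2)
    (Submodule.smul_mem _ (P.γ * P.β : ℂ) hU.mem.p_mem_H2.2)
  have m2 := sub_mem (Submodule.smul_mem _ (P.β : ℂ) hU.mem.p_mem_H2.2)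
    (Submodule.smul_mem _ (P.γ * P.β : ℂ) hU.mem.v_mem_H2.2)
  obtain ⟨w1, hw1⟩ := exists_hasBoundaryValue P.ℓ₂_pos m1 P.ℓ₂
  obtain ⟨w2, hw2⟩ := exists_hasBoundaryValue P.ℓ₂_pos m2 P.ℓ₂
  obtain ⟨q0, hq0⟩ := exists_hasBoundaryValue P.ℓ₂_pos hU.mem.Q_mem.1 0
  have i1 := inner_wderiv_add hℓ₁ hU.mem.z_mem_H2.1 hU.mem.z_mem_H2.2 hU.mem.z_mem_H1.2 hz0 hzl hzx
  have i2 := inner_wderiv_add P.ℓ₂_pos hU.mem.V_mem.1 m1 hV0 hU.mem.V_mem.2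
    ((hvx.smul _).sub (hpx.smul _)) hw1
  have i3 := inner_wderiv_add P.ℓ₂_pos hU.mem.Q_mem.1 m2 hq0 hU.mem.Q_mem.2
    ((hpx.smul _).sub (hvx.smul _)) hw2
  have dV : wderiv U.V = s • wderiv U.v := by rw [hU.velocity, wderiv_smul _ hU.mem.v_mem_H2.1]
  have dQ : wderiv U.Q = s • wderiv U.p := by rw [hU.current, wderiv_smul _ hU.mem.p_mem_H2.1]
  have hz : (P.κ : ℂ) * inner ℂ U.z (wderiv (wderiv U.z)) = s * (‖U.z‖ : ℂ) ^ 2 := by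
    rw [← inner_smul_right, hU.heat, inner_smul_right, inner_self_eq_norm_sq_to_K]
    rfl
  rw [hU.stretch, dV] at i2
  rw [hU.charge, dQ] at i3
  simp only [inner_smul_left, inner_smul_right, inner_sub_right, inner_self_eq_norm_sq_to_K,
    map_zero, zero_mul, zero_sub, sub_zero, Complex.coe_algebraMap] at i1 i2 i3
  have hsym : inner ℂ (wderiv U.p) (wderiv U.v) = conj (inner ℂ (wderiv U.v) (wderiv U.p)) :=
    (inner_conj_symm _ _).symm
  rw [hsym] at i3
  have hconj : conj s = -s := by
    apply Complex.ext
    · simp [hs.re_eq]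
    · simp
  -- The boundary terms at `0` cancel by the transmission conditions.
  have total : (P.κ : ℂ) * (‖wderiv U.z‖ : ℂ) ^ 2 + s * (‖U.z‖ : ℂ) ^ 2
      + (P.ρ * s + P.𝔠 * memoryCoeff P s) * (‖U.V‖ : ℂ) ^ 2 + P.μ * s * (‖U.Q‖ : ℂ) ^ 2
      - s * (P.χ * (‖wderiv U.v‖ : ℂ) ^ 2 + P.β * (‖wderiv U.p‖ : ℂ) ^ 2
        - P.γ * P.β * (inner ℂ (wderiv U.v) (wderiv U.p)
          + conj (inner ℂ (wderiv U.v) (wderiv U.p)))) = 0 := by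
    rw [hconj] at i2 i3
    linear_combination (P.κ : ℂ) * i1 - hz + i2 + i3 - conj z0 * f1 - conj q0 * f2
  rw [Complex.add_conj] at total
  -- The elastic energy is real, so its product with the imaginary `s` has no real part.
  have hre := congrArg Complex.re total
  simpa [hs.re_eq, ← Complex.ofReal_pow] using hre

/-- The operator `s - 𝒜` is injective for admissible `s`. -/
theorem Admissible.eq_zero_of_generatorFun_eq (hs : Admissible P s) {U : EnergySpace P}
    (hU : InDomain U) (h : generatorFun U hU = s • U) : U = 0 := by
  have hE := hs.eigen hU h
  have hdiss := hE.dissipation_eq_zero hs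
  have hc := hs.re_memoryCoeff_pos
  have hℓ₁ : -P.ℓ₁ < 0 := neg_lt_zero.2 P.ℓ₁_pos
  have a1 : 0 ≤ P.κ * ‖wderiv U.z‖ ^ 2 := mul_nonneg P.κ_pos.le (sq_nonneg _)
  have a2 : 0 ≤ P.𝔠 * (memoryCoeff P s).re * ‖U.V‖ ^ 2 :=
    mul_nonneg (mul_pos P.𝔠_pos hc).le (sq_nonneg _)
  have b1 : P.κ * ‖wderiv U.z‖ ^ 2 = 0 := by linarith
  have b2 : P.𝔠 * (memoryCoeff P s).re * ‖U.V‖ ^ 2 = 0 := by linarith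
  have hzx : wderiv U.z = 0 := by simpa [P.κ_pos.ne'] using b1
  have hV : U.V = 0 := by simpa [(mul_pos P.𝔠_pos hc).ne', P.𝔠_pos.ne', hc.ne'] using b2
  have hz : U.z = 0 := eq_zero_of_wderiv_eq_zero hℓ₁ ⟨le_rfl, hℓ₁.le⟩ hU.z_mem_H1 hzx
  have hφ : U.φ = 0 := by rw [hs.φ_eq hU h, hV, memorySolution_zero]
  obtain ⟨c, vx, px, f0, f1, f2, f3, f4⟩ := hU.flux
  have hc0 : c = 0 := by
    rw [hzx] at f0
    exact f0.unique hℓ₁ ⟨hℓ₁.le, le_rfl⟩ (HasBoundaryValue.zero 0)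
  have m0 : (0 : ℝ) ∈ Icc 0 P.ℓ₂ := ⟨le_rfl, P.ℓ₂_pos.le⟩
  -- The stress vanishes: its derivative is proportional to `V` and its value at `0` to `z_x(0)`.
  have w1 : (P.χ : ℂ) • wderiv U.v - (P.γ * P.β : ℂ) • wderiv U.p = 0 := by
    refine eq_zero_of_wderiv_eq_zero (x₀ := 0) P.ℓ₂_pos m0
      ⟨sub_mem (Submodule.smul_mem _ _ hU.v_mem_H2.2) (Submodule.smul_mem _ _ hU.p_mem_H2.2), ?_⟩
      (by rw [hE.stretch, hV, smul_zero])
    have := (f1.smul (P.χ : ℂ)).sub (f2.smul (P.γ * P.β : ℂ))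
    rwa [f3, hc0, mul_zero] at this
  have hvp : wderiv U.v = 0 ∧ wderiv U.p = 0 := by
    by_cases h0 : s = 0
    · have w2 : (P.β : ℂ) • wderiv U.p - (P.γ * P.β : ℂ) • wderiv U.v = 0 := by
        refine eq_zero_of_wderiv_eq_zero (x₀ := 0) P.ℓ₂_pos m0
          ⟨sub_mem (Submodule.smul_mem _ _ hU.p_mem_H2.2) (Submodule.smul_mem _ _ hU.v_mem_H2.2),
            ?_⟩ (by rw [hE.charge, h0, mul_zero, zero_smul])
        have := (f2.smul (P.β : ℂ)).sub (f1.smul (P.γ * P.β : ℂ))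
        rwa [f4, sub_self] at this
      have hβ : (P.β : ℂ) ≠ 0 := Complex.ofReal_ne_zero.2 P.β_pos.ne'
      have hχ : (P.χ₁ : ℂ) ≠ 0 := Complex.ofReal_ne_zero.2 P.χ₁_pos.ne'
      have hv : wderiv U.v = 0 := by
        have : (P.χ₁ : ℂ) • wderiv U.v = 0 := by
          rw [Params.χ₁]
          push_cast
          linear_combination (norm := module) w1 + (P.γ : ℂ) • w2
        exact (smul_eq_zero.1 this).resolve_left hχ
      refine ⟨hv, ?_⟩
      rw [hv, smul_zero, sub_zero] at w2
      exact (smul_eq_zero.1 w2).resolve_left hβ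
    · have hv : U.v = 0 := by
        have := hE.velocity
        rw [hV] at this
        exact (smul_eq_zero.1 this.symm).resolve_left h0
      have hvx : wderiv U.v = 0 := by rw [hv, wderiv_zero]
      refine ⟨hvx, ?_⟩
      rw [hvx, smul_zero, zero_sub, neg_eq_zero] at w1
      exact (smul_eq_zero.1 w1).resolve_left (mul_ne_zero (Complex.ofReal_ne_zero.2 P.γ_ne)
        (Complex.ofReal_ne_zero.2 P.β_pos.ne'))
  have hv := eq_zero_of_wderiv_eq_zero P.ℓ₂_pos P.ℓ₂_mem U.v_mem hvp.1
  have hp := eq_zero_of_wderiv_eq_zero P.ℓ₂_pos P.ℓ₂_mem U.p_mem hvp.2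
  exact EnergySpace.ext' hz hv hV hp (by rw [hE.current, hp, smul_zero]; rfl) hφ

/-! ### Reduction of the resolvent equation to a compact fixed point problem -/

/-- The value at `y` of the primitive that vanishes at `x₀`, as a bounded functional. -/
def primitiveAt (a b x₀ y : ℝ) : L2 a b →L[ℂ] ℂ := partialIntegral a b y - partialIntegral a b x₀

theorem hasBoundaryValue_primitiveAt {a b : ℝ} (x₀ y : ℝ) (g : L2 a b) :
    HasBoundaryValue (primitive a b x₀ g) y (primitiveAt a b x₀ y g) :=
  hasBoundaryValue_primitive x₀ y g

/-- The space of the reduced unknowns `(d, a, q, d₀)`, which stand for `z_x`, `v_x`,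
`p_x - γ v_x` and `z_x(0)`. -/
abbrev Reduced (P : Params) : Type := L2 (-P.ℓ₁) 0 × L2 0 P.ℓ₂ × L2 0 P.ℓ₂ × ℂ

/-- Reduced unknowns together with a right-hand side of the resolvent equation. -/
abbrev ReducedData (P : Params) : Type := Reduced P × EnergySpace P

namespace ReducedData

open ContinuousLinearMap

/-- The unknown `d = z_x`. -/
def dL (P : Params) : ReducedData P →L[ℂ] L2 (-P.ℓ₁) 0 := fst ℂ _ _ ∘L fst ℂ _ _

/-- The unknown `a = v_x`. -/
def aL (P : Params) : ReducedData P →L[ℂ] L2 0 P.ℓ₂ := fst ℂ _ _ ∘L snd ℂ _ _ ∘L fst ℂ _ _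

/-- The unknown `q = p_x - γ v_x`. -/
def qL (P : Params) : ReducedData P →L[ℂ] L2 0 P.ℓ₂ :=
  fst ℂ _ _ ∘L snd ℂ _ _ ∘L snd ℂ _ _ ∘L fst ℂ _ _

/-- The unknown `d₀ = z_x(0)`. -/
def traceL (P : Params) : ReducedData P →L[ℂ] ℂ :=
  snd ℂ _ _ ∘L snd ℂ _ _ ∘L snd ℂ _ _ ∘L fst ℂ _ _

/-- The right-hand side `f`. -/
def rhsL (P : Params) : ReducedData P →L[ℂ] EnergySpace P := snd ℂ _ _

/-- The state component `z`. -/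
def stateZ (P : Params) : ReducedData P →L[ℂ] L2 (-P.ℓ₁) 0 := primitive (-P.ℓ₁) 0 (-P.ℓ₁) ∘L dL P

/-- The state component `V = s v - f₂`. -/
def stateV (P : Params) (s : ℂ) : ReducedData P →L[ℂ] L2 0 P.ℓ₂ :=
  primitive 0 P.ℓ₂ P.ℓ₂ ∘L (s • aL P - EnergySpace.vxL P ∘L rhsL P)

/-- The derivative `p_x = q + γ v_x`. -/
def statePx (P : Params) : ReducedData P →L[ℂ] L2 0 P.ℓ₂ := qL P + (P.γ : ℂ) • aL P

/-- The state component `Q = s p - f₄`. -/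
def stateQ (P : Params) (s : ℂ) : ReducedData P →L[ℂ] L2 0 P.ℓ₂ :=
  primitive 0 P.ℓ₂ P.ℓ₂ ∘L (s • statePx P - EnergySpace.pxL P ∘L rhsL P)

/-- The state component `φ`. -/
def stateφ (hs : Admissible P s) : ReducedData P →L[ℂ] MemorySpace P :=
  divSymbol hs ∘L EnergySpace.φL P ∘L rhsL P + memoryLift hs ∘L stateV P s

/-- The state described by the reduced unknowns and the right-hand side. -/
def state (hs : Admissible P s) : ReducedData P →L[ℂ] EnergySpace P :=
  EnergySpace.ofDerivL P ∘L (stateZ P).prod ((aL P).prod ((stateV P s).prod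
    ((statePx P).prod ((stateQ P s).prod (stateφ hs)))))

/-- The second derivative of `z`. -/
def rateD (P : Params) (s : ℂ) : ReducedData P →L[ℂ] L2 (-P.ℓ₁) 0 :=
  (P.κ : ℂ)⁻¹ • (s • stateZ P - EnergySpace.zL P ∘L rhsL P)

/-- The derivative of `q = p_x - γ v_x`, obtained from the equation for `Q`. -/
def rateQ (P : Params) (s : ℂ) : ReducedData P →L[ℂ] L2 0 P.ℓ₂ :=
  ((P.β : ℂ)⁻¹ * P.μ) • (s • stateQ P s - EnergySpace.QL P ∘L rhsL P)

/-- The second derivative of `v`, obtained by eliminating `p_xx` from the equation for `V`. -/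
def rateA (hs : Admissible P s) : ReducedData P →L[ℂ] L2 0 P.ℓ₂ :=
  (P.χ₁ : ℂ)⁻¹ • ((P.ρ : ℂ) • (s • stateV P s - EnergySpace.VL P ∘L rhsL P)
    + (P.𝔠 : ℂ) • (memoryPairing hs ∘L EnergySpace.φL P ∘L rhsL P
      + memoryCoeff P s • stateV P s) + (P.γ * P.β : ℂ) • rateQ P s)

/-- The defect `z(0) - V(0)` in the velocity condition. -/
def velocityDefect (P : Params) (s : ℂ) : ReducedData P →L[ℂ] ℂ :=
  primitiveAt (-P.ℓ₁) 0 (-P.ℓ₁) 0 ∘L dL P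
    - primitiveAt 0 P.ℓ₂ P.ℓ₂ 0 ∘L (s • aL P - EnergySpace.vxL P ∘L rhsL P)

/-- The map whose fixed points in the first variable are the reduced unknowns of the solutions of
the resolvent equation: the unknowns are recovered from their derivatives and their values
at `0`. -/
def reducedMap (hs : Admissible P s) : ReducedData P →L[ℂ] Reduced P :=
  (primitive (-P.ℓ₁) 0 0 ∘L rateD P s + (traceL P).smulRight (one (-P.ℓ₁) 0)).prod
    ((primitive 0 P.ℓ₂ 0 ∘L rateA hs
      + ((P.χ₁ : ℂ)⁻¹ * P.κ) • (traceL P).smulRight (one 0 P.ℓ₂)).prod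
    ((primitive 0 P.ℓ₂ 0 ∘L rateQ P s).prod (traceL P - velocityDefect P s)))

theorem isCompactOperator_prod {E F G : Type*} [NormedAddCommGroup E] [NormedSpace ℂ E]
    [NormedAddCommGroup F] [NormedSpace ℂ F] [NormedAddCommGroup G] [NormedSpace ℂ G]
    {f : E →L[ℂ] F} {g : E →L[ℂ] G} (hf : IsCompactOperator f) (hg : IsCompactOperator g) :
    IsCompactOperator (f.prod g) := by
  have h := (hf.clm_comp (inl ℂ F G)).add (hg.clm_comp (inr ℂ F G))
  have e : (f.prod g : E → F × G) = inl ℂ F G ∘ f + inr ℂ F G ∘ g := funext fun x => by simp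
  rwa [e]

theorem isCompactOperator_smulRight {E F : Type*} [NormedAddCommGroup E] [NormedSpace ℂ E]
    [NormedAddCommGroup F] [NormedSpace ℂ F] (f : E →L[ℂ] ℂ) (y : F) :
    IsCompactOperator (f.smulRight y) :=
  (isCompactOperator_of_locallyCompactSpace_dom f).clm_comp (toSpanSingleton ℂ y)

/-- All components but the finite-dimensional ones factor through a primitive. -/
theorem isCompactOperator_reducedMap (hs : Admissible P s) :
    IsCompactOperator (reducedMap hs) := by
  refine isCompactOperator_prod ?_ (isCompactOperator_prod ?_ (isCompactOperator_prod ?_ ?_))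
  · exact ((isCompactOperator_primitive 0).comp_clm (rateD P s)).add
      (isCompactOperator_smulRight _ _)
  · exact ((isCompactOperator_primitive 0).comp_clm (rateA hs)).add
      ((isCompactOperator_smulRight _ _).smul _)
  · exact (isCompactOperator_primitive 0).comp_clm (rateQ P s)
  · exact isCompactOperator_of_locallyCompactSpace_dom _

theorem state_z (hs : Admissible P s) (X : ReducedData P) :
    (state hs X).z = primitive (-P.ℓ₁) 0 (-P.ℓ₁) (dL P X) := rfl
theorem state_v (hs : Admissible P s) (X : ReducedData P) :
    (state hs X).v = primitive 0 P.ℓ₂ P.ℓ₂ (aL P X) := rfl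
theorem state_p (hs : Admissible P s) (X : ReducedData P) :
    (state hs X).p = primitive 0 P.ℓ₂ P.ℓ₂ (statePx P X) := rfl
theorem state_φ (hs : Admissible P s) (X : ReducedData P) :
    (state hs X).φ = memorySolution hs (rhsL P X).φ (stateV P s X) := rfl

/-- The equations satisfied by a fixed point of the reduced map. -/
theorem equations_of_fixed (hs : Admissible P s) (X : ReducedData P) (h : reducedMap hs X = X.1) :
    dL P X = primitive (-P.ℓ₁) 0 0 (rateD P s X) + traceL P X • one (-P.ℓ₁) 0 ∧
    aL P X = primitive 0 P.ℓ₂ 0 (rateA hs X) + ((P.χ₁ : ℂ)⁻¹ * P.κ * traceL P X) • one 0 P.ℓ₂ ∧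
    qL P X = primitive 0 P.ℓ₂ 0 (rateQ P s X) ∧ velocityDefect P s X = 0 := by
  refine ⟨(congrArg (fun x => x.1) h).symm, ?_, (congrArg (fun x => x.2.2.1) h).symm, ?_⟩
  · rw [mul_smul]
    exact (congrArg (fun x => x.2.1) h).symm
  · have h4 : traceL P X - velocityDefect P s X = traceL P X := congrArg (fun x => x.2.2.2) h
    exact sub_eq_self.1 h4

theorem stateV_eq (s : ℂ) (X : ReducedData P) :
    stateV P s X = s • primitive 0 P.ℓ₂ P.ℓ₂ (aL P X) - (rhsL P X).v := by
  rw [← EnergySpace.primitive_vxL, ← map_smul, ← map_sub]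
  rfl

theorem stateQ_eq (s : ℂ) (X : ReducedData P) :
    stateQ P s X = s • primitive 0 P.ℓ₂ P.ℓ₂ (statePx P X) - (rhsL P X).p := by
  rw [← EnergySpace.primitive_pxL, ← map_smul, ← map_sub]
  rfl

theorem hasWeakDeriv_dL (hs : Admissible P s) {X : ReducedData P} (h : reducedMap hs X = X.1) :
    HasWeakDeriv (dL P X) (rateD P s X) := by
  have := (hasWeakDeriv_primitive (a := -P.ℓ₁) (b := 0) 0 (rateD P s X)).add
    (hasWeakDeriv_one.smul (traceL P X))
  rwa [← (equations_of_fixed hs X h).1, smul_zero, add_zero] at this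

theorem hasWeakDeriv_aL (hs : Admissible P s) {X : ReducedData P} (h : reducedMap hs X = X.1) :
    HasWeakDeriv (aL P X) (rateA hs X) := by
  have := (hasWeakDeriv_primitive (a := 0) (b := P.ℓ₂) 0 (rateA hs X)).add
    (hasWeakDeriv_one.smul ((P.χ₁ : ℂ)⁻¹ * P.κ * traceL P X))
  rwa [← (equations_of_fixed hs X h).2.1, smul_zero, add_zero] at this

theorem hasWeakDeriv_statePx (hs : Admissible P s) {X : ReducedData P}
    (h : reducedMap hs X = X.1) :
    HasWeakDeriv (statePx P X) (rateQ P s X + (P.γ : ℂ) • rateA hs X) := by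
  have := hasWeakDeriv_primitive (a := 0) (b := P.ℓ₂) 0 (rateQ P s X)
  rw [← (equations_of_fixed hs X h).2.2.1] at this
  exact this.add ((hasWeakDeriv_aL hs h).smul (P.γ : ℂ))

theorem inDomain_state (hs : Admissible P s) {X : ReducedData P} (h : reducedMap hs X = X.1) :
    InDomain (state hs X) where
  z_mem_H1 := primitive_mem_H1Vanishing _ _
  z_mem_H2 := ⟨primitive_mem_H1 _ _, by
    rw [state_z, wderiv_primitive]; exact ⟨_, hasWeakDeriv_dL hs h⟩⟩
  v_mem_H2 := ⟨primitive_mem_H1 _ _, by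
    rw [state_v, wderiv_primitive]; exact ⟨_, hasWeakDeriv_aL hs h⟩⟩
  p_mem_H2 := ⟨primitive_mem_H1 _ _, by
    rw [state_p, wderiv_primitive]; exact ⟨_, hasWeakDeriv_statePx hs h⟩⟩
  V_mem := primitive_mem_H1Vanishing _ _
  Q_mem := primitive_mem_H1Vanishing _ _
  weight_memLp := memLp_weight_memorySolution hs _ _
  rate_memLp := (memLp_congr_ae (rate_memorySolution hs (rhsL P X).φ (stateV P s X))).2
    (Lp.memLp _)
  velocity := by
    refine ⟨_, hasBoundaryValue_primitiveAt (-P.ℓ₁) 0 (dL P X), ?_⟩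
    have h4 : primitiveAt (-P.ℓ₁) 0 (-P.ℓ₁) 0 (dL P X) = primitiveAt 0 P.ℓ₂ P.ℓ₂ 0
        ((s • aL P - EnergySpace.vxL P ∘L rhsL P) X) :=
      sub_eq_zero.1 (equations_of_fixed hs X h).2.2.2
    have h5 := hasBoundaryValue_primitiveAt P.ℓ₂ 0
      ((s • aL P - EnergySpace.vxL P ∘L rhsL P) X)
    rw [h4]
    exact h5
  flux := by
    obtain ⟨h1, h2, h3, -⟩ := equations_of_fixed hs X h
    have b1 : HasBoundaryValue (dL P X) 0 (traceL P X) := by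
      have := (hasBoundaryValue_primitive (a := -P.ℓ₁) (b := 0) 0 0 (rateD P s X)).add
        ((hasBoundaryValue_one 0).smul (traceL P X))
      rwa [← h1, sub_self, zero_add, mul_one] at this
    have b2 : HasBoundaryValue (aL P X) 0 ((P.χ₁ : ℂ)⁻¹ * P.κ * traceL P X) := by
      have := (hasBoundaryValue_primitive (a := 0) (b := P.ℓ₂) 0 0 (rateA hs X)).add
        ((hasBoundaryValue_one 0).smul ((P.χ₁ : ℂ)⁻¹ * P.κ * traceL P X))
      rwa [← h2, sub_self, zero_add, mul_one] at this
    have b3 : HasBoundaryValue (qL P X) 0 0 := by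
      have := hasBoundaryValue_primitive (a := 0) (b := P.ℓ₂) 0 0 (rateQ P s X)
      rwa [← h3, sub_self] at this
    have b4 : HasBoundaryValue (statePx P X) 0
        (0 + P.γ * ((P.χ₁ : ℂ)⁻¹ * P.κ * traceL P X)) := b3.add (b2.smul (P.γ : ℂ))
    have hχ : (P.χ₁ : ℂ) ≠ 0 := Complex.ofReal_ne_zero.2 P.χ₁_pos.ne'
    have hχ' : (P.χ₁ : ℂ) = P.χ - P.γ ^ 2 * P.β := by rw [Params.χ₁]; push_cast; rfl
    refine ⟨_, _, _, by rw [state_z, wderiv_primitive]; exact b1,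
      by rw [state_v, wderiv_primitive]; exact b2,
      by rw [state_p, wderiv_primitive]; exact b4, ?_, by ring⟩
    have : (P.χ₁ : ℂ) * (P.χ₁ : ℂ)⁻¹ = 1 := mul_inv_cancel₀ hχ
    rw [hχ'] at this
    rw [hχ']
    linear_combination (P.κ * traceL P X) * this

/-- A fixed point of the reduced map solves the resolvent equation. -/
theorem smul_state_sub_generatorFun (hs : Admissible P s) {X : ReducedData P}
    (h : reducedMap hs X = X.1) :
    s • state hs X - generatorFun (state hs X) (inDomain_state hs h) = rhsL P X := by
  have hκ : (P.κ : ℂ) ≠ 0 := Complex.ofReal_ne_zero.2 P.κ_pos.ne'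
  have hρ : (P.ρ : ℂ) ≠ 0 := Complex.ofReal_ne_zero.2 P.ρ_pos.ne'
  have hμ : (P.μ : ℂ) ≠ 0 := Complex.ofReal_ne_zero.2 P.μ_pos.ne'
  have hβ : (P.β : ℂ) ≠ 0 := Complex.ofReal_ne_zero.2 P.β_pos.ne'
  have hχ : (P.χ₁ : ℂ) ≠ 0 := Complex.ofReal_ne_zero.2 P.χ₁_pos.ne'
  have hχ' : (P.χ : ℂ) = P.χ₁ + P.γ ^ 2 * P.β := by rw [Params.χ₁]; push_cast; ring
  have dz : wderiv (wderiv (state hs X).z) = rateD P s X := by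
    rw [state_z, wderiv_primitive]; exact (hasWeakDeriv_dL hs h).wderiv_eq
  have dv : wderiv (wderiv (state hs X).v) = rateA hs X := by
    rw [state_v, wderiv_primitive]; exact (hasWeakDeriv_aL hs h).wderiv_eq
  have dp : wderiv (wderiv (state hs X).p) = rateQ P s X + (P.γ : ℂ) • rateA hs X := by
    rw [state_p, wderiv_primitive]; exact (hasWeakDeriv_statePx hs h).wderiv_eq
  have hF : memoryForce (state hs X)
      = memoryPairing hs (rhsL P X).φ + memoryCoeff P s • stateV P s X := by
    rw [memoryForce, state_φ, integral_memorySolution]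
  have eD : (P.κ : ℂ) • rateD P s X = s • stateZ P X - (rhsL P X).z := smul_inv_smul₀ hκ _
  have eQ : (P.β : ℂ) • rateQ P s X = (P.μ : ℂ) • (s • stateQ P s X - (rhsL P X).Q) := by
    have : rateQ P s X = ((P.β : ℂ)⁻¹ * P.μ) • (s • stateQ P s X - (rhsL P X).Q) := rfl
    rw [this, mul_smul, smul_inv_smul₀ hβ]
  have eA : (P.χ₁ : ℂ) • rateA hs X = (P.ρ : ℂ) • (s • stateV P s X - (rhsL P X).V)
      + (P.𝔠 : ℂ) • (memoryPairing hs (rhsL P X).φ + memoryCoeff P s • stateV P s X)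
      + (P.γ * P.β : ℂ) • rateQ P s X := smul_inv_smul₀ hχ _
  rw [sub_eq_iff_eq_add, ← sub_eq_iff_eq_add']
  symm
  refine EnergySpace.ext' ?_ ?_ ?_ ?_ ?_ ?_
  · change (P.κ : ℂ) • wderiv (wderiv (state hs X).z) = s • stateZ P X - (rhsL P X).z
    rw [dz, eD]
  · change stateV P s X = s • primitive 0 P.ℓ₂ P.ℓ₂ (aL P X) - (rhsL P X).v
    exact stateV_eq s X
  · change stretchRate (state hs X) = s • stateV P s X - (rhsL P X).V
    rw [stretchRate, dv, dp, hF, inv_smul_eq_iff₀ hρ, hχ']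
    linear_combination (norm := module) eA
  · change stateQ P s X = s • primitive 0 P.ℓ₂ P.ℓ₂ (statePx P X) - (rhsL P X).p
    exact stateQ_eq s X
  · change chargeRate (state hs X) = s • stateQ P s X - (rhsL P X).Q
    rw [chargeRate, dv, dp, inv_smul_eq_iff₀ hμ]
    linear_combination (norm := module) eQ
  · change (inDomain_state hs h).rate_memLp.toLp (memoryRate (state hs X))
      = s • (state hs X).φ - (rhsL P X).φ
    refine Lp.ext ((MemLp.coeFn_toLp _).trans ?_)
    exact rate_memorySolution hs (rhsL P X).φ (stateV P s X)

end ReducedData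

/-! ### The resolvent -/

open ReducedData

/-- The compact operator of the reduced problem. -/
def reducedOp (hs : Admissible P s) : Reduced P →L[ℂ] Reduced P :=
  reducedMap hs ∘L ContinuousLinearMap.inl ℂ (Reduced P) (EnergySpace P)

/-- A fixed point of the homogeneous reduced problem is the reduction of an eigenvector. -/
theorem Admissible.eq_zero_of_reducedOp_eq (hs : Admissible P s) {x : Reduced P}
    (hx : reducedOp hs x = x) : x = 0 := by
  have h : reducedMap hs (x, 0) = ((x, 0) : ReducedData P).1 := hx
  have h1 := smul_state_sub_generatorFun hs h
  have h2 := hs.eq_zero_of_generatorFun_eq (inDomain_state hs h) (sub_eq_zero.1 h1).symm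
  obtain ⟨e1, e2, e3, -⟩ := equations_of_fixed hs (x, 0) h
  have d0 : dL P (x, 0) = 0 := by
    have := congrArg (fun U => wderiv U.z) h2
    simpa only [state_z, wderiv_primitive, EnergySpace.zero_z, wderiv_zero] using this
  have a0 : aL P (x, 0) = 0 := by
    have := congrArg (fun U => wderiv U.v) h2
    simpa only [state_v, wderiv_primitive, EnergySpace.zero_v, wderiv_zero] using this
  have p0 : statePx P (x, 0) = 0 := by
    have := congrArg (fun U => wderiv U.p) h2
    simpa only [state_p, wderiv_primitive, EnergySpace.zero_p, wderiv_zero] using this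
  have q0 : qL P (x, 0) = 0 := by
    have : qL P (x, 0) + (P.γ : ℂ) • aL P (x, 0) = 0 := p0
    rwa [a0, smul_zero, add_zero] at this
  have hℓ₁ : -P.ℓ₁ < 0 := neg_lt_zero.2 P.ℓ₁_pos
  have t0 : traceL P (x, 0) = 0 := by
    have b := (hasBoundaryValue_primitive (a := -P.ℓ₁) (b := 0) 0 0 (rateD P s (x, 0))).add
      ((hasBoundaryValue_one 0).smul (traceL P (x, 0)))
    rw [← e1, sub_self, zero_add, mul_one, d0] at b
    exact b.unique hℓ₁ ⟨hℓ₁.le, le_rfl⟩ (HasBoundaryValue.zero 0)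
  exact Prod.ext d0 (Prod.ext a0 (Prod.ext q0 t0))

/-- The Fredholm alternative for the reduced problem. -/
theorem Admissible.isUnit (hs : Admissible P s) : IsUnit (1 - reducedOp hs) := by
  have hc : IsCompactOperator (reducedOp hs) := (isCompactOperator_reducedMap hs).comp_clm _
  rcases hc.hasEigenvalue_or_mem_resolventSet (one_ne_zero (α := ℂ)) with h | h
  · obtain ⟨x, hx⟩ := h.exists_hasEigenvector
    refine absurd (hs.eq_zero_of_reducedOp_eq (x := x) ?_) hx.2
    simpa using hx.apply_eq_smul
  · simpa [spectrum.mem_resolventSet_iff] using h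

theorem Admissible.mem_resolventSet (hs : Admissible P s) : s ∈ resolventSet (generator P) := by
  obtain ⟨u, hu⟩ := hs.isUnit
  let T : Reduced P →L[ℂ] Reduced P := ↑u⁻¹
  have hT : ∀ y, T y - reducedOp hs (T y) = y := fun y => by
    have h : ((1 - reducedOp hs) * T) y = y := by rw [← hu, Units.mul_inv]; rfl
    exact h
  -- The reduced problem for the right-hand side `f` is `x - reducedOp x = b f`.
  let b : EnergySpace P →L[ℂ] Reduced P :=
    reducedMap hs ∘L ContinuousLinearMap.inr ℂ (Reduced P) (EnergySpace P)
  let R : EnergySpace P →L[ℂ] EnergySpace P :=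
    state hs ∘L (T ∘L b).prod (ContinuousLinearMap.id ℂ (EnergySpace P))
  have hfix : ∀ f, reducedMap hs (T (b f), f) = ((T (b f), f) : ReducedData P).1 := fun f => by
    have h1 : ((T (b f), f) : ReducedData P) = (T (b f), 0) + (0, f) := by simp
    rw [h1, map_add, ← h1]
    exact (eq_add_of_sub_eq' (hT (b f))).symm
  have hR : ∀ f, ∃ h : InDomain (R f), s • R f - generatorFun (R f) h = f := fun f =>
    ⟨inDomain_state hs (hfix f), smul_state_sub_generatorFun hs (hfix f)⟩
  refine ⟨R, hR, fun w => ?_⟩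
  -- `R (s w - 𝒜 w) - w` is in the kernel of `s - 𝒜`.
  obtain ⟨h, h'⟩ := hR (s • (w : EnergySpace P) - generator P w)
  let x : (generator P).domain := ⟨R (s • (w : EnergySpace P) - generator P w), h⟩
  have h1 : s • (x : EnergySpace P) - generator P x
      = s • (w : EnergySpace P) - generator P w := h'
  have h2 : generator P (x - w) = s • ((x : EnergySpace P) - w) := by
    rw [LinearPMap.map_sub, smul_sub]
    linear_combination (norm := module) -h1
  exact sub_eq_zero.1 (hs.eq_zero_of_generatorFun_eq (x - w).2 h2)

end System

end PiezoHeat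

end

theorem mainTheorem3 (P : PiezoHeat.Params) :
    (0 < P.η →
      {s : ℂ | ∃ τ : ℝ, s = Complex.I * τ} ⊆ PiezoHeat.resolventSet (PiezoHeat.generator P)) ∧
    (P.η = 0 →
      {s : ℂ | ∃ τ : ℝ, τ ≠ 0 ∧ s = Complex.I * τ} ⊆
        PiezoHeat.resolventSet (PiezoHeat.generator P)) := by
  refine ⟨?_, ?_⟩
  · rintro hη s ⟨τ, rfl⟩
    exact PiezoHeat.Admissible.mem_resolventSet ⟨by simp, Or.inl hη⟩
  · rintro - s ⟨τ, hτ, rfl⟩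
    exact PiezoHeat.Admissible.mem_resolventSet ⟨by simp, Or.inr (by simpa using hτ)⟩
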